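/- Let $\lambda\ge 4$ be an integer, let $\mathbb D_4=\{Z\in \mathrm{Mat}_{2\times2}(\mathbb C): I-ZZ^\dagger>0\}$, and let $$d\nu_\lambda(Z)=c_\lambda\det(I-ZZ^\dagger)^{\lambda-4}\,|dZ|,\qquad c_\lambda=\pi^{-4}(\lambda-1)(\lambda-2)^2(\lambda-3),$$ where $|dZ|$ is Lebesgue measure on $\mathbb C^4\cong\mathrm{Mat}_{2\times2}(\mathbb C)$. Let $L^2_h(\mathbb D_4,d\nu_\lambda)$ be the space of holomorphic functions on $\mathbb D_4$ that are square integrable with respect to $\nu_\lambda$, with inner product $\langle\phi|\phi'\rangle=\int_{\mathbb D_4}\overline{\phi(Z)}\,\phi'(Z)\,d\nu_\lambda(Z)$. For $j\in\{0,\tfrac12,1,\tfrac32,\dots\}$ and $q_1,q_2\in\{-j,-j+1,\dots,j\}$ let $$\mathcal D^{j}_{q_1,q_2}(Z)=\sqrt{\frac{(j+q_1)!(j-q_1)!}{(j+q_2)!(j-q_2)!}}\sum_{k=\max(0,q_1+q_2)}^{\min(j+q_1,j+q_2)}\binom{j+q_2}{k}\binom{j-q_2}{k-q_1-q_2}\,z_{11}^{k}\,z_{12}^{j+q_1-k}\,z_{21}^{j+q_2-k}\,z_{22}^{k-q_1-q_2},$$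 and for $m\in\{0,1,2,\dots\}$ let $$\varphi^{j,m}_{q_1,q_2}(Z)=\sqrt{\frac{2j+1}{\lambda-1}\binom{m+\lambda-2}{\lambda-2}\binom{m+2j+\lambda-1}{\lambda-2}}\;\det(Z)^m\,\mathcal D^{j}_{q_1,q_2}(Z).$$ Then each $\varphi^{j,m}_{q_1,q_2}$ is a homogeneous polynomial of degree $2j+2m$ in the entries of $Z$ that is square integrable with respect to $\nu_\lambda$, one has $$\langle\varphi^{j,m}_{q_1,q_2}|\varphi^{j',m'}_{q_1',q_2'}\rangle=\delta_{j,j'}\,\delta_{m,m'}\,\delta_{q_1,q_1'}\,\delta_{q_2,q_2'},$$ and the functions $\varphi^{j,m}_{q_1,q_2}$ (over all $j,m,q_1,q_2$ as above) form an orthonormal Hilbert basis of $L^2_h(\mathbb D_4,d\nu_\lambda)$. -/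

import Mathlib

open MeasureTheory
open scoped ComplexOrder ComplexConjugate

/-- The space `ℂ⁴` of complex `2 × 2` matrices `Z`, as arrays of entries `Z i j`. Its `volume` is
the product Lebesgue measure `|dZ|` of the real and imaginary parts of the four entries. -/
abbrev MatSpace : Type := Fin 2 → Fin 2 → ℂ

/-- The Cartan domain `D₄ = {Z : I - Z Z† > 0}`. -/
def cartanDomain : Set MatSpace :=
  {Z | (1 - Matrix.of Z * (Matrix.of Z).conjTranspose).PosDef}

/-- The constant `c_λ = π⁻⁴ (λ - 1) (λ - 2)² (λ - 3)`. -/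
noncomputable def normConst (lam : ℕ) : ℝ :=
  (Real.pi ^ 4)⁻¹ * ((lam : ℝ) - 1) * ((lam : ℝ) - 2) ^ 2 * ((lam : ℝ) - 3)

/-- The measure `dν_λ = c_λ det(I - Z Z†)^(λ - 4) |dZ|` on `D₄` (the determinant is a positive real
number on `D₄`), as a measure on `ℂ⁴` that vanishes outside `D₄`. -/
noncomputable def nuMeasure (lam : ℕ) : Measure MatSpace :=
  (volume.restrict cartanDomain).withDensity fun Z =>
    ENNReal.ofReal (normConst lam *
      (Matrix.det (1 - Matrix.of Z * (Matrix.of Z).conjTranspose)).re ^ ((lam : ℤ) - 4))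

/-- The space `L²_h(D₄, dν_λ)`: the classes in `L²(D₄, dν_λ)` of functions holomorphic on `D₄`,
with the inner product `⟨f, g⟩ = ∫ conj f * g dν_λ` of `L²`. -/
noncomputable def holoL2 (lam : ℕ) : Submodule ℂ (Lp ℂ 2 (nuMeasure lam)) where
  carrier := {f | ∃ g : MatSpace → ℂ, DifferentiableOn ℂ g cartanDomain ∧ f =ᵐ[nuMeasure lam] g}
  zero_mem' := ⟨0, differentiableOn_const 0, Lp.coeFn_zero ℂ 2 (nuMeasure lam)⟩
  add_mem' := by
    rintro f f' ⟨g, hg, hfg⟩ ⟨g', hg', hfg'⟩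
    exact ⟨g + g', hg.add hg', (Lp.coeFn_add f f').trans (hfg.add hfg')⟩
  smul_mem' := by
    rintro c f ⟨g, hg, hfg⟩
    exact ⟨c • g, hg.const_smul c, (Lp.coeFn_smul c f).trans (hfg.const_smul c)⟩

/-- Wigner's `D`-matrix `D^j_{q₁,q₂}(X)` as a polynomial in the entries of `X`. The half-integers
`j`, `q₁`, `q₂` are given by the natural numbers `n = 2j`, `a = j + q₁ ≤ n`, `b = j + q₂ ≤ n`, so that
`j - q₁ = n - a`, `j - q₂ = n - b`, `q₁ + q₂ = a + b - n`. The lower limit `a + b - n` of the sum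
(truncated subtraction) is `max(0, q₁ + q₂)`; no other subtraction is truncated. -/
noncomputable def wignerD (n a b : ℕ) (X : MatSpace) : ℂ :=
  (Real.sqrt (((a.factorial * (n - a).factorial : ℕ) : ℝ) /
      ((b.factorial * (n - b).factorial : ℕ) : ℝ)) : ℂ) *
    ∑ k ∈ Finset.Icc (a + b - n) (min a b),
      (b.choose k : ℂ) * ((n - b).choose (k + n - (a + b)) : ℂ) *
        X 0 0 ^ k * X 0 1 ^ (a - k) * X 1 0 ^ (b - k) * X 1 1 ^ (k + n - (a + b))

/-- The index set of all `(j, m, q₁, q₂)` with `m ∈ ℕ`, `j ∈ ℕ/2` and `q₁, q₂ ∈ {-j, -j+1, …, j}`: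
an element `⟨(n, m), (a, b)⟩` stands for `j = n/2`, `q₁ = a - j`, `q₂ = b - j`. -/
abbrev BasisIndex : Type := Σ p : ℕ × ℕ, Fin (p.1 + 1) × Fin (p.1 + 1)

/-- The function `φ^{j,m}_{q₁,q₂}(Z)`, which is `det(Z)^m D^j_{q₁,q₂}(Z)` times the square root of
`(2j+1)/(λ-1) * binom(m+λ-2, λ-2) * binom(m+2j+λ-1, λ-2)`. -/
noncomputable def basisFun (lam : ℕ) (i : BasisIndex) (Z : MatSpace) : ℂ :=
  (Real.sqrt (((i.1.1 : ℝ) + 1) / ((lam : ℝ) - 1) *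
      ((i.1.2 + lam - 2).choose (lam - 2) : ℝ) *
      ((i.1.2 + i.1.1 + lam - 1).choose (lam - 2) : ℝ)) : ℂ) *
    (Matrix.of Z).det ^ i.1.2 * wignerD i.1.1 i.2.1 i.2.2 Z

/-!
# An orthonormal basis of the Bergman space of the Cartan domain `D₄`

The measure `ν_λ` is invariant under `Z ↦ U Z V` with `U`, `V` unitary
(`measurePreserving_biMul`), and this determines the inner products up to one scalar for each
`(n, m)`. The elements `D_{ab}` of degree `n` are, up to explicit factors, the coefficients of the
generating function `(αᵀ Z β)ⁿ` (`pairing_pow`). Rotating `α` and `β` onto the first axis turns an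
inner product of two functions `det(Z)ᵐ (αᵀ Z β)ⁿ` into one against the highest weight vector
`det(Z)ᵐ z₁₁ⁿ`, and there the diagonal tori leave a single term. Hence the inner product is
`⟨α, α'⟩ⁿ ⟨β, β'⟩ⁿ ‖det(Z)ᵐ z₁₁ⁿ‖²` if `(n, m) = (n', m')` and `0` otherwise
(`integral_conj_detPairing`); comparing coefficients in `α, β, α', β'` gives all orthogonality
relations (`integral_conj_detWigner`).

The remaining norm is an explicit integral. Fix the first row `v` of `Z` and write the second row as
`S_v w`, where `S_v` is a square root of `I - v v†` (rows regarded as column vectors) adapted to the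
direction of `v` (`fibreMatrix`). Then `det Z = |v| w₁` and
`det(I - Z Z†) = (1 - |v|²)(1 - |w|²)`, so that the integral becomes a product of two integrals over
the unit ball of `ℂ²` (`lintegral_nuMeasure_pow_mul_det_pow`), which are Beta integrals.

For completeness, let `g` be holomorphic, square integrable and orthogonal to all basis functions.
The `d`-th derivative of `ζ ↦ g(ζ Z)` at `0` is a homogeneous polynomial `P_d(Z)` of degree `d`
(`exists_homPoly_iteratedDeriv`), and averaging over the circle `ζ = e^{iθ}` gives
`⟨P, g⟩ = ⟨P, P_d⟩ / d!` for every homogeneous polynomial `P` of degree `d`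
(`integral_conj_mul_eq_integral_taylor`). Since `D_{ab}` is modulo `det(Z)` a positive multiple of
each monomial of its weight, the basis functions span all polynomials (`homPoly_le_wignerSpan`).
Taking `P = P_d` shows `P_d = 0` for all `d`, so `g = 0`. That `L²_h` is a Hilbert space follows from
the mean value property, which makes point evaluations locally uniformly bounded
(`exists_norm_le_mul_norm`, `isClosed_holoL2`).
-/

/-! ### The Cartan domain in coordinates -/

/-- The squared Euclidean norm of a row of a `2 × 2` matrix, or of any vector of `ℂ²`. -/
noncomputable def sqNorm (v : Fin 2 → ℂ) : ℝ := ‖v 0‖ ^ 2 + ‖v 1‖ ^ 2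

/-- The real number `det(I - Z Z†) = 1 - tr(Z Z†) + |det Z|²`. -/
noncomputable def detGap (Z : MatSpace) : ℝ :=
  1 - (sqNorm (Z 0) + sqNorm (Z 1)) + ‖Z 0 0 * Z 1 1 - Z 0 1 * Z 1 0‖ ^ 2

lemma sqNorm_nonneg (v : Fin 2 → ℂ) : 0 ≤ sqNorm v := by unfold sqNorm; positivity

lemma sqNorm_pos {v : Fin 2 → ℂ} (hv : v ≠ 0) : 0 < sqNorm v := by
  by_contra! h
  have e0 : ‖v 0‖ ^ 2 = 0 := by
    unfold sqNorm at h; nlinarith [sq_nonneg ‖v 0‖, sq_nonneg ‖v 1‖]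
  have e1 : ‖v 1‖ ^ 2 = 0 := by
    unfold sqNorm at h; nlinarith [sq_nonneg ‖v 0‖, sq_nonneg ‖v 1‖]
  simp only [ne_eq, OfNat.ofNat_ne_zero, not_false_eq_true, pow_eq_zero_iff,
    norm_eq_zero] at e0 e1
  apply hv
  ext i
  fin_cases i <;> simp [e0, e1]

lemma norm_lt_two_of_sqNorm_add_lt {Z : MatSpace} (h : sqNorm (Z 0) + sqNorm (Z 1) < 2) :
    ‖Z‖ < 2 := by
  unfold sqNorm at h
  rw [pi_norm_lt_iff two_pos]
  intro i
  rw [pi_norm_lt_iff two_pos]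
  intro j
  have h4 : ‖Z i j‖ ^ 2 < 2 := by
    have := sq_nonneg ‖Z 0 0‖
    have := sq_nonneg ‖Z 0 1‖
    have := sq_nonneg ‖Z 1 0‖
    have := sq_nonneg ‖Z 1 1‖
    fin_cases i <;> fin_cases j <;> simp only [Fin.zero_eta, Fin.mk_one] <;> linarith
  nlinarith [norm_nonneg (Z i j)]

lemma continuous_sqNorm : Continuous sqNorm := by unfold sqNorm; fun_prop

lemma continuous_detGap : Continuous detGap := by
  unfold detGap
  have := continuous_sqNorm
  fun_prop

lemma sq_norm_eq_conj_mul (z : ℂ) : ((‖z‖ ^ 2 : ℝ) : ℂ) = conj z * z := by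
  rw [← Complex.normSq_eq_norm_sq, Complex.normSq_eq_conj_mul_self]

lemma det_one_sub_mul_conjTranspose (Z : MatSpace) :
    Matrix.det (1 - Matrix.of Z * (Matrix.of Z).conjTranspose) = (detGap Z : ℂ) := by
  unfold detGap sqNorm
  push_cast
  simp only [← Complex.ofReal_pow, sq_norm_eq_conj_mul]
  simp [Matrix.det_fin_two, Matrix.mul_apply, Fin.sum_univ_two]
  ring

/-- The Lagrange identity: `det(I - Z Z†) = (1 - |Z₀|²)(1 - |Z₁|²) - |⟨Z₁, Z₀⟩|²`. -/
lemma detGap_eq (Z : MatSpace) :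
    detGap Z = (1 - sqNorm (Z 0)) * (1 - sqNorm (Z 1)) -
      ‖Z 0 0 * conj (Z 1 0) + Z 0 1 * conj (Z 1 1)‖ ^ 2 := by
  apply Complex.ofReal_injective
  unfold detGap sqNorm
  push_cast
  simp only [← Complex.ofReal_pow, sq_norm_eq_conj_mul]
  simp
  ring

/-- Sylvester's criterion for `I - Z Z†`. -/
lemma mem_cartanDomain_iff (Z : MatSpace) :
    Z ∈ cartanDomain ↔ sqNorm (Z 0) < 1 ∧ 0 < detGap Z := by
  constructor
  · intro h
    have h : (1 - Matrix.of Z * (Matrix.of Z).conjTranspose).PosDef := h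
    refine ⟨?_, ?_⟩
    · have h0 := h.diag_pos (i := 0)
      have : (1 - Matrix.of Z * (Matrix.of Z).conjTranspose) 0 0
          = ((1 - sqNorm (Z 0) : ℝ) : ℂ) := by
        unfold sqNorm
        push_cast
        simp only [← Complex.ofReal_pow, sq_norm_eq_conj_mul]
        simp [Matrix.mul_apply, Fin.sum_univ_two]
        ring
      rw [this, Complex.zero_lt_real] at h0
      linarith
    · have h0 := h.det_pos
      rwa [det_one_sub_mul_conjTranspose, Complex.zero_lt_real] at h0
  · rintro ⟨h0, h1⟩
    change (1 - Matrix.of Z * (Matrix.of Z).conjTranspose).PosDef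
    rw [Matrix.posDef_iff_dotProduct_mulVec]
    refine ⟨?_, fun x hx => ?_⟩
    · simp [Matrix.IsHermitian, Matrix.conjTranspose_sub, Matrix.conjTranspose_mul]
    set c : ℂ := Z 0 0 * conj (Z 1 0) + Z 0 1 * conj (Z 1 1) with hc
    set A := 1 - sqNorm (Z 0) with hA
    set B := 1 - sqNorm (Z 1) with hB
    have hA0 : 0 < A := by rw [hA]; linarith
    have hD : 0 < A * B - ‖c‖ ^ 2 := by rw [← detGap_eq]; exact h1
    have key : star x ⬝ᵥ (1 - Matrix.of Z * (Matrix.of Z).conjTranspose).mulVec x =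
        ((A⁻¹ * (‖(A : ℂ) * x 0 - c * x 1‖ ^ 2 + (A * B - ‖c‖ ^ 2) * ‖x 1‖ ^ 2) : ℝ) : ℂ) := by
      have hAc : (A : ℂ) ≠ 0 := by exact_mod_cast hA0.ne'
      have hA' : (A : ℂ) = 1 - (conj (Z 0 0) * Z 0 0 + conj (Z 0 1) * Z 0 1) := by
        rw [hA]; unfold sqNorm; push_cast
        simp only [← Complex.ofReal_pow, sq_norm_eq_conj_mul]
      have hB' : (B : ℂ) = 1 - (conj (Z 1 0) * Z 1 0 + conj (Z 1 1) * Z 1 1) := by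
        rw [hB]; unfold sqNorm; push_cast
        simp only [← Complex.ofReal_pow, sq_norm_eq_conj_mul]
      have h1 : star x ⬝ᵥ (1 - Matrix.of Z * (Matrix.of Z).conjTranspose).mulVec x =
          A * conj (x 0) * x 0 + B * conj (x 1) * x 1 - conj (x 0) * c * x 1
            - conj (x 1) * conj c * x 0 := by
        rw [hA', hB', hc]
        simp [Matrix.mulVec, dotProduct, Matrix.mul_apply, Fin.sum_univ_two]
        ring
      rw [h1]
      push_cast
      simp only [← Complex.ofReal_pow, sq_norm_eq_conj_mul]
      rw [eq_inv_mul_iff_mul_eq₀ hAc]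
      simp only [map_sub, map_mul, Complex.conj_ofReal]
      ring
    rw [key, Complex.zero_lt_real]
    apply mul_pos (inv_pos.2 hA0)
    by_cases hx1 : x 1 = 0
    · have hx0 : x 0 ≠ 0 := by
        intro h
        apply hx
        ext i
        fin_cases i <;> simp [h, hx1]
      simp only [hx1, mul_zero, sub_zero, norm_zero, norm_mul]
      have : 0 < ‖x 0‖ := norm_pos_iff.2 hx0
      have : 0 < ‖(A : ℂ)‖ := norm_pos_iff.2 (by exact_mod_cast hA0.ne')
      positivity
    · have : 0 < ‖x 1‖ := norm_pos_iff.2 hx1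
      positivity

lemma mem_cartanDomain_iff_trace (Z : MatSpace) :
    Z ∈ cartanDomain ↔ sqNorm (Z 0) + sqNorm (Z 1) < 2 ∧ 0 < detGap Z := by
  rw [mem_cartanDomain_iff]
  have h := detGap_eq Z
  have hc := sq_nonneg ‖Z 0 0 * conj (Z 1 0) + Z 0 1 * conj (Z 1 1)‖
  constructor
  · rintro ⟨h0, h1⟩
    refine ⟨?_, h1⟩
    by_contra! h2
    nlinarith
  · rintro ⟨h0, h1⟩
    refine ⟨?_, h1⟩
    by_contra! h2
    nlinarith

lemma isOpen_cartanDomain : IsOpen cartanDomain := by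
  have : cartanDomain = {Z | sqNorm (Z 0) < 1} ∩ {Z | 0 < detGap Z} := by
    ext Z; exact mem_cartanDomain_iff Z
  rw [this]
  have h := continuous_sqNorm
  exact (isOpen_lt (by fun_prop) continuous_const).inter
    (isOpen_lt continuous_const continuous_detGap)

lemma measurableSet_cartanDomain : MeasurableSet cartanDomain :=
  isOpen_cartanDomain.measurableSet

lemma norm_lt_of_mem_cartanDomain {Z : MatSpace} (hZ : Z ∈ cartanDomain) : ‖Z‖ < 2 :=
  norm_lt_two_of_sqNorm_add_lt ((mem_cartanDomain_iff_trace Z).1 hZ).1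

lemma detGap_le_one {Z : MatSpace} (hZ : Z ∈ cartanDomain) : detGap Z ≤ 1 := by
  have h := detGap_eq Z
  have h1 := (mem_cartanDomain_iff Z).1 hZ
  have h0 := sqNorm_nonneg (Z 0)
  have h2 := sqNorm_nonneg (Z 1)
  have hc := sq_nonneg ‖Z 0 0 * conj (Z 1 0) + Z 0 1 * conj (Z 1 1)‖
  nlinarith

lemma zero_mem_cartanDomain : (0 : MatSpace) ∈ cartanDomain := by
  rw [mem_cartanDomain_iff]
  simp [sqNorm, detGap]

/-- The Cartan domain is balanced. -/
lemma smul_mem_cartanDomain {Z : MatSpace} (hZ : Z ∈ cartanDomain) {t : ℂ} (ht : ‖t‖ ≤ 1) :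
    t • Z ∈ cartanDomain := by
  rw [mem_cartanDomain_iff] at hZ ⊢
  obtain ⟨h0, h1⟩ := hZ
  have hs : ∀ i, sqNorm ((t • Z) i) = ‖t‖ ^ 2 * sqNorm (Z i) := by
    intro i; simp [sqNorm]; ring
  have ht2 : ‖t‖ ^ 2 ≤ 1 := pow_le_one₀ (norm_nonneg t) ht
  have ht0 := sq_nonneg ‖t‖
  have hn0 := sqNorm_nonneg (Z 0)
  have hn1 := sqNorm_nonneg (Z 1)
  refine ⟨by rw [hs]; nlinarith, ?_⟩
  have hd : ‖(t • Z) 0 0 * (t • Z) 1 1 - (t • Z) 0 1 * (t • Z) 1 0‖ ^ 2 =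
      (‖t‖ ^ 2) ^ 2 * ‖Z 0 0 * Z 1 1 - Z 0 1 * Z 1 0‖ ^ 2 := by
    have : (t • Z) 0 0 * (t • Z) 1 1 - (t • Z) 0 1 * (t • Z) 1 0 =
        t ^ 2 * (Z 0 0 * Z 1 1 - Z 0 1 * Z 1 0) := by
      simp; ring
    rw [this, norm_mul, norm_pow, mul_pow]
  unfold detGap
  rw [hd, hs, hs]
  have hl := detGap_eq Z
  unfold detGap at hl h1
  have hc := sq_nonneg ‖Z 0 0 * conj (Z 1 0) + Z 0 1 * conj (Z 1 1)‖
  generalize ‖Z 0 0 * conj (Z 1 0) + Z 0 1 * conj (Z 1 1)‖ ^ 2 = c at *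
  generalize ‖Z 0 0 * Z 1 1 - Z 0 1 * Z 1 0‖ ^ 2 = d at *
  generalize ‖t‖ ^ 2 = s at *
  generalize sqNorm (Z 0) = a at *
  generalize sqNorm (Z 1) = b at *
  have hb : b < 1 := by nlinarith
  -- `1 - s(a+b) + s²d = (1-sa)(1-sb) - s²c` with `c < (1-a)(1-b)` and `s ≤ 1`
  have e : 1 - (s * a + s * b) + s ^ 2 * d = (1 - s * a) * (1 - s * b) - s ^ 2 * c := by
    linear_combination s ^ 2 * hl
  rw [e]
  have hc' : c < (1 - a) * (1 - b) := by linarith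
  have h3 : (1 - a) * (1 - b) ≤ (1 - s * a) * (1 - s * b) :=
    mul_le_mul (by nlinarith) (by nlinarith) (by linarith) (by nlinarith)
  have h4 : s ^ 2 * c ≤ c := mul_le_of_le_one_left hc (pow_le_one₀ ht0 ht2)
  linarith

/-! ### The measure `ν_λ` -/

instance isAddHaarMeasure_volume_matSpace : (volume : Measure MatSpace).IsAddHaarMeasure :=
  Measure.pi.isAddHaarMeasure fun _ : Fin 2 => (volume : Measure (Fin 2 → ℂ))

/-- The density of `ν_λ` on the Cartan domain. -/
noncomputable def nuDensity (lam : ℕ) (Z : MatSpace) : ℝ :=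
  normConst lam * detGap Z ^ (lam - 4)

lemma continuous_nuDensity (lam : ℕ) : Continuous (nuDensity lam) := by
  have := continuous_detGap
  unfold nuDensity
  fun_prop

lemma normConst_pos {lam : ℕ} (h : 4 ≤ lam) : 0 < normConst lam := by
  have h' : (4 : ℝ) ≤ lam := by exact_mod_cast h
  unfold normConst
  have h1 : (0 : ℝ) < lam - 1 := by linarith
  have h2 : (0 : ℝ) < lam - 2 := by linarith
  have h3 : (0 : ℝ) < lam - 3 := by linarith
  positivity

lemma nuDensity_pos {lam : ℕ} (h : 4 ≤ lam) {Z : MatSpace} (hZ : Z ∈ cartanDomain) :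
    0 < nuDensity lam Z :=
  mul_pos (normConst_pos h) (pow_pos ((mem_cartanDomain_iff Z).1 hZ).2 _)

lemma nuMeasure_eq {lam : ℕ} (h : 4 ≤ lam) :
    nuMeasure lam = (volume.restrict cartanDomain).withDensity
      fun Z => ENNReal.ofReal (nuDensity lam Z) := by
  unfold nuMeasure nuDensity
  have : ((lam : ℤ) - 4) = ((lam - 4 : ℕ) : ℤ) := by omega
  simp only [det_one_sub_mul_conjTranspose, Complex.ofReal_re, this, zpow_natCast]

lemma measurable_nuDensity (lam : ℕ) :
    Measurable fun Z => ENNReal.ofReal (nuDensity lam Z) :=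
  (continuous_nuDensity lam).measurable.ennreal_ofReal

lemma ae_mem_cartanDomain (lam : ℕ) : ∀ᵐ Z ∂(nuMeasure lam), Z ∈ cartanDomain := by
  have h : nuMeasure lam ≪ volume.restrict cartanDomain := withDensity_absolutelyContinuous _ _
  exact h (ae_restrict_mem measurableSet_cartanDomain)

lemma lintegral_nuMeasure {lam : ℕ} (h : 4 ≤ lam) {F : MatSpace → ENNReal} (hF : Measurable F) :
    ∫⁻ Z, F Z ∂(nuMeasure lam) =
      ∫⁻ Z in cartanDomain, ENNReal.ofReal (nuDensity lam Z) * F Z := by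
  rw [nuMeasure_eq h, lintegral_withDensity_eq_lintegral_mul _ (measurable_nuDensity lam) hF]
  rfl

lemma isFiniteMeasure_nuMeasure {lam : ℕ} (h : 4 ≤ lam) : IsFiniteMeasure (nuMeasure lam) := by
  constructor
  have h1 := lintegral_nuMeasure h (F := fun _ => 1) measurable_const
  rw [lintegral_one] at h1
  rw [h1]
  have hfin : volume cartanDomain < ⊤ := by
    refine lt_of_le_of_lt (measure_mono (fun Z hZ => ?_))
      (Metric.isBounded_ball (x := (0 : MatSpace)) (r := 2)).measure_lt_top
    simpa using norm_lt_of_mem_cartanDomain hZ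
  refine lt_of_le_of_lt (setLIntegral_mono' measurableSet_cartanDomain
    (g := fun _ => ENNReal.ofReal (normConst lam)) fun Z hZ => ?_) ?_
  · rw [mul_one]
    apply ENNReal.ofReal_le_ofReal
    exact mul_le_of_le_one_right (normConst_pos h).le
      (pow_le_one₀ ((mem_cartanDomain_iff Z).1 hZ).2.le (detGap_le_one hZ))
  · rw [setLIntegral_const]
    exact ENNReal.mul_lt_top ENNReal.ofReal_lt_top hfin

lemma Continuous.memLp_nuMeasure {lam : ℕ} (h : 4 ≤ lam) {f : MatSpace → ℂ} (hf : Continuous f)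
    (p : ENNReal) : MemLp f p (nuMeasure lam) := by
  have := isFiniteMeasure_nuMeasure h
  obtain ⟨C, hC⟩ := (isCompact_closedBall (0 : MatSpace) 2).exists_bound_of_continuousOn
    hf.continuousOn
  refine MemLp.of_bound hf.aestronglyMeasurable C ?_
  filter_upwards [ae_mem_cartanDomain lam] with Z hZ
  exact hC Z (by simpa using (norm_lt_of_mem_cartanDomain hZ).le)

/-! ### Unitary invariance -/

/-- A linear endomorphism of `ℂ⁴` that preserves the Hilbert–Schmidt norm preserves Lebesgue
measure: the Hilbert–Schmidt unit ball is its own preimage, so the real determinant is `±1`. -/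
lemma measurePreserving_volume_of_sqNorm (T : MatSpace →ₗ[ℂ] MatSpace)
    (hT : ∀ Z, sqNorm (T Z 0) + sqNorm (T Z 1) = sqNorm (Z 0) + sqNorm (Z 1)) :
    MeasurePreserving T volume volume := by
  have hcont : Continuous T := T.continuous_of_finiteDimensional
  set L : MatSpace →ₗ[ℝ] MatSpace := T.restrictScalars ℝ with hL
  have hLT : ⇑L = T := rfl
  have hdet : LinearMap.det L ≠ 0 := by
    have hinj : Function.Injective L := by
      rw [injective_iff_map_eq_zero]
      intro Z hZ
      have h1 := hT Z
      have hZ' : T Z = 0 := hZ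
      rw [hZ'] at h1
      have hz : sqNorm 0 = 0 := by simp [sqNorm]
      simp only [Pi.zero_apply, hz, add_zero] at h1
      have h2 := sqNorm_nonneg (Z 0)
      have h3 := sqNorm_nonneg (Z 1)
      ext1 i
      by_contra hi
      have h4 : 0 < sqNorm (Z i) := sqNorm_pos hi
      fin_cases i <;> simp only [Fin.zero_eta, Fin.mk_one] at h4 <;> linarith
    exact (LinearEquiv.isUnit_det' (LinearEquiv.ofInjectiveEndo L hinj)).ne_zero
  set S : Set MatSpace := {Z | sqNorm (Z 0) + sqNorm (Z 1) < 1} with hS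
  have hSo : IsOpen S := by
    have := continuous_sqNorm
    exact isOpen_lt (by fun_prop) continuous_const
  have hS0 : volume S ≠ 0 :=
    (hSo.measure_pos volume ⟨0, by simp [hS, sqNorm]⟩).ne'
  have hS1 : volume S ≠ ⊤ := by
    refine (lt_of_le_of_lt (measure_mono (fun Z hZ => ?_))
      (Metric.isBounded_ball (x := (0 : MatSpace)) (r := 2)).measure_lt_top).ne
    have hZ' : sqNorm (Z 0) + sqNorm (Z 1) < 1 := hZ
    rw [mem_ball_zero_iff]
    exact norm_lt_two_of_sqNorm_add_lt (by linarith)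
  have hpre : L ⁻¹' S = S := by
    ext Z
    simp only [hS, Set.mem_preimage, Set.mem_ofPred_eq, hLT, hT]
  have h1 := Measure.addHaar_preimage_linearMap (volume : Measure MatSpace) hdet S
  rw [hpre] at h1
  have hc : ENNReal.ofReal |(LinearMap.det L)⁻¹| = 1 := by
    have := (ENNReal.mul_eq_right hS0 hS1).1 h1.symm
    exact this
  refine ⟨hcont.measurable, ?_⟩
  have h2 := Measure.map_linearMap_addHaar_eq_smul_addHaar (volume : Measure MatSpace) hdet
  rwa [hc, one_smul, hLT] at h2

/-- Linear maps preserving `tr(Z Z†)` and `det(I - Z Z†)` preserve `ν_λ`. -/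
lemma measurePreserving_nuMeasure {lam : ℕ} (h : 4 ≤ lam) (T : MatSpace →ₗ[ℂ] MatSpace)
    (hT : ∀ Z, sqNorm (T Z 0) + sqNorm (T Z 1) = sqNorm (Z 0) + sqNorm (Z 1))
    (hT' : ∀ Z, detGap (T Z) = detGap Z) :
    MeasurePreserving T (nuMeasure lam) (nuMeasure lam) := by
  have hv := measurePreserving_volume_of_sqNorm T hT
  refine ⟨hv.measurable, ?_⟩
  ext s hs
  rw [Measure.map_apply hv.measurable hs, nuMeasure_eq h,
    withDensity_apply _ hs, withDensity_apply _ (hv.measurable hs)]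
  have hpre : T ⁻¹' cartanDomain = cartanDomain := by
    ext Z
    rw [Set.mem_preimage, mem_cartanDomain_iff_trace, mem_cartanDomain_iff_trace, hT, hT']
  rw [Measure.restrict_restrict hs, Measure.restrict_restrict (hv.measurable hs)]
  have := hv.setLIntegral_comp_preimage (hs.inter measurableSet_cartanDomain)
    (measurable_nuDensity lam)
  rw [Set.preimage_inter, hpre] at this
  rw [← this]
  simp only [nuDensity, hT']

/-- The linear map `Z ↦ U Z V`. -/
noncomputable def biMul (U V : Matrix (Fin 2) (Fin 2) ℂ) : MatSpace →ₗ[ℂ] MatSpace where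
  toFun Z := U * Matrix.of Z * V
  map_add' Z W := by
    change U * (Matrix.of Z + Matrix.of W) * V = _
    rw [mul_add, add_mul]; rfl
  map_smul' c Z := by
    change U * (c • Matrix.of Z) * V = _
    rw [Matrix.mul_smul, Matrix.smul_mul]; rfl

lemma biMul_apply (U V : Matrix (Fin 2) (Fin 2) ℂ) (Z : MatSpace) :
    Matrix.of (biMul U V Z) = U * Matrix.of Z * V := rfl

lemma trace_mul_conjTranspose (Z : MatSpace) :
    Matrix.trace (Matrix.of Z * (Matrix.of Z).conjTranspose) =
      ((sqNorm (Z 0) + sqNorm (Z 1) : ℝ) : ℂ) := by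
  unfold sqNorm
  push_cast
  simp only [← Complex.ofReal_pow, sq_norm_eq_conj_mul]
  simp [Matrix.trace, Matrix.mul_apply, Fin.sum_univ_two]
  ring

lemma measurePreserving_biMul {lam : ℕ} (h : 4 ≤ lam) {U V : Matrix (Fin 2) (Fin 2) ℂ}
    (hU : U.conjTranspose * U = 1) (hV : V * V.conjTranspose = 1) :
    MeasurePreserving (biMul U V) (nuMeasure lam) (nuMeasure lam) := by
  have hU' : U * U.conjTranspose = 1 := mul_eq_one_comm.1 hU
  have key : ∀ Z, Matrix.of (biMul U V Z) * (Matrix.of (biMul U V Z)).conjTranspose =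
      U * (Matrix.of Z * (Matrix.of Z).conjTranspose) * U.conjTranspose := by
    intro Z
    rw [biMul_apply, Matrix.conjTranspose_mul, Matrix.conjTranspose_mul]
    calc _ = U * Matrix.of Z * (V * V.conjTranspose) *
          ((Matrix.of Z).conjTranspose * U.conjTranspose) := by simp only [mul_assoc]
      _ = _ := by rw [hV]; simp only [mul_assoc, mul_one]
  apply measurePreserving_nuMeasure h
  · intro Z
    apply Complex.ofReal_injective
    rw [← trace_mul_conjTranspose, ← trace_mul_conjTranspose, key, Matrix.trace_mul_comm,
      ← mul_assoc, hU, one_mul]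
  · intro Z
    apply Complex.ofReal_injective
    rw [← det_one_sub_mul_conjTranspose, ← det_one_sub_mul_conjTranspose, key]
    have : 1 - U * (Matrix.of Z * (Matrix.of Z).conjTranspose) * U.conjTranspose =
        U * (1 - Matrix.of Z * (Matrix.of Z).conjTranspose) * U.conjTranspose := by
      rw [mul_sub, sub_mul, mul_one, hU']
    rw [this, Matrix.det_mul_comm, ← mul_assoc, hU, one_mul]

/-! ### Radial integrals -/

lemma integral_pow_mul_one_sub_pow (p q : ℕ) :
    ∫ u in (0 : ℝ)..1, u ^ p * (1 - u) ^ q =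
      (p.factorial * q.factorial : ℝ) / (p + q + 1).factorial := by
  have hp : (0 : ℝ) < (p : ℝ) + 1 := by positivity
  have hq : (0 : ℝ) < (q : ℝ) + 1 := by positivity
  have h := ProbabilityTheory.beta_eq_betaIntegralReal (p + 1) (q + 1) hp hq
  have h2 : (Complex.betaIntegral ((p + 1 : ℝ) : ℂ) ((q + 1 : ℝ) : ℂ)) =
      ((∫ u in (0 : ℝ)..1, u ^ p * (1 - u) ^ q : ℝ) : ℂ) := by
    rw [Complex.betaIntegral, ← intervalIntegral.integral_ofReal]
    congr 1
    ext u
    simp [Complex.cpow_natCast]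
  rw [h2, Complex.ofReal_re] at h
  rw [← h, ProbabilityTheory.beta, Real.Gamma_nat_eq_factorial, Real.Gamma_nat_eq_factorial]
  have : ((p : ℝ) + 1 + (q + 1)) = ((p + q + 1 : ℕ) : ℝ) + 1 := by push_cast; ring
  rw [this, Real.Gamma_nat_eq_factorial]

lemma lintegral_pow_mul_one_sub_pow (p q : ℕ) :
    ∫⁻ u in Set.Ioo (0 : ℝ) 1, ENNReal.ofReal (u ^ p * (1 - u) ^ q) =
      ENNReal.ofReal ((p.factorial * q.factorial : ℝ) / (p + q + 1).factorial) := by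
  rw [← integral_pow_mul_one_sub_pow, intervalIntegral.integral_of_le zero_le_one,
    integral_Ioc_eq_integral_Ioo, ofReal_integral_eq_lintegral_ofReal]
  · exact ((by fun_prop : Continuous fun u : ℝ => u ^ p * (1 - u) ^ q).integrableOn_Icc).mono_set
      Set.Ioo_subset_Icc_self
  · filter_upwards [ae_restrict_mem measurableSet_Ioo] with u hu
    have h0 := hu.1.le
    have h1 : 0 ≤ 1 - u := by linarith [hu.2]
    simp only [Pi.zero_apply]
    positivity

/-- Integration of a function of `|z|²` over the plane: the map `z ↦ |z|²` sends the area to `π`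
times Lebesgue measure on the half-line. -/
lemma lintegral_comp_norm_sq {F : ℝ → ENNReal} (hF : Measurable F) :
    ∫⁻ z : ℂ, F (‖z‖ ^ 2) = ENNReal.ofReal Real.pi * ∫⁻ r in Set.Ioi (0 : ℝ), F r := by
  rw [← Complex.lintegral_comp_polarCoord_symm]
  have himg : (fun r : ℝ => r ^ 2) '' Set.Ioi 0 = Set.Ioi 0 := by
    ext x
    constructor
    · rintro ⟨r, hr, rfl⟩
      exact pow_pos (Set.mem_Ioi.1 hr) 2
    · intro hx
      exact ⟨√x, Real.sqrt_pos.2 hx, Real.sq_sqrt (le_of_lt hx)⟩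
  have h1 := lintegral_image_eq_lintegral_abs_deriv_mul (s := Set.Ioi (0 : ℝ))
    (f := fun r => r ^ 2) (f' := fun r => 2 * r) measurableSet_Ioi
    (fun x _ => by simpa using (hasDerivAt_pow 2 x).hasDerivWithinAt)
    (fun a ha b hb hab => (pow_left_inj₀ (le_of_lt ha) (le_of_lt hb) two_ne_zero).1 hab) F
  rw [himg] at h1
  rw [h1, polarCoord_target, Measure.volume_eq_prod, ← Measure.prod_restrict]
  have h2 : ∀ p : ℝ × ℝ, F (‖Complex.polarCoord.symm p‖ ^ 2) = F (p.1 ^ 2) := by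
    intro p; rw [Complex.norm_polarCoord_symm, sq_abs]
  simp only [h2]
  rw [lintegral_prod _ (by fun_prop)]
  simp only [smul_eq_mul, lintegral_const, Measure.restrict_apply MeasurableSet.univ,
    Set.univ_inter, Real.volume_Ioo]
  rw [lintegral_mul_const _ (by fun_prop), mul_comm, ← lintegral_const_mul _ (by fun_prop),
    ← lintegral_const_mul _ (by fun_prop)]
  refine setLIntegral_congr_fun measurableSet_Ioi fun r hr => ?_
  have hr : (0 : ℝ) < r := hr
  rw [abs_of_pos (by positivity), ← mul_assoc, ← mul_assoc]
  rw [← ENNReal.ofReal_mul (by linarith [Real.pi_pos]),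
    ← ENNReal.ofReal_mul (by positivity)]
  congr 2
  ring

/-- The integral of `r ^ n u ^ m (1 - u) ^ k` over the triangle `0 < r < u < 1`, in the coordinates
`(r, q)` with `u = r + q`. -/
lemma lintegral_triangle (n m k : ℕ) :
    ∫⁻ r in Set.Ioi (0 : ℝ), ∫⁻ q in Set.Ioi (0 : ℝ),
      (if r + q < 1 then ENNReal.ofReal (r ^ n * (r + q) ^ m * (1 - (r + q)) ^ k) else 0) =
    ENNReal.ofReal (((n + m + 1).factorial * k.factorial : ℝ) /
      ((n + m + k + 2).factorial * (n + 1))) := by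
  set h : ℝ → ENNReal := fun u => if u < 1 then ENNReal.ofReal (u ^ m * (1 - u) ^ k) else 0 with hh
  have hmeas : Measurable h := by
    refine Measurable.ite measurableSet_Iio ?_ measurable_const
    fun_prop
  -- substitute `u = r + q` in the inner integral
  have h1 : ∀ r ∈ Set.Ioi (0 : ℝ), ∫⁻ q in Set.Ioi (0 : ℝ),
      (if r + q < 1 then ENNReal.ofReal (r ^ n * (r + q) ^ m * (1 - (r + q)) ^ k) else 0) =
      ∫⁻ u in Set.Ioi (0 : ℝ), (Set.Ioo 0 u).indicator (fun r => ENNReal.ofReal (r ^ n)) r * h u := by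
    intro r hr
    have hr : (0 : ℝ) < r := hr
    rw [← lintegral_indicator measurableSet_Ioi, ← lintegral_indicator measurableSet_Ioi]
    symm
    rw [← lintegral_add_left_eq_self (μ := volume) _ r]
    symm
    refine lintegral_congr fun q => ?_
    by_cases hq : 0 < q
    · have hrq : 0 < r + q := by linarith
      rw [Set.indicator_of_mem (Set.mem_Ioi.2 hq), Set.indicator_of_mem (Set.mem_Ioi.2 hrq),
        Set.indicator_of_mem (Set.mem_Ioo.2 ⟨hr, by linarith⟩)]
      simp only [hh]
      split_ifs
      · rw [← ENNReal.ofReal_mul (by positivity), mul_assoc]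
      · simp
    · rw [Set.indicator_of_notMem (by simpa using hq)]
      by_cases hrq : 0 < r + q
      · rw [Set.indicator_of_mem (Set.mem_Ioi.2 hrq), Set.indicator_of_notMem, zero_mul]
        rintro ⟨-, h⟩
        linarith
      · rw [Set.indicator_of_notMem (by simpa using hrq)]
  rw [setLIntegral_congr_fun measurableSet_Ioi h1]
  rw [lintegral_lintegral_swap]
  swap
  · apply Measurable.aemeasurable
    have : (Function.uncurry fun (r u : ℝ) =>
        (Set.Ioo 0 u).indicator (fun r => ENNReal.ofReal (r ^ n)) r * h u) =
        fun p : ℝ × ℝ => ({p : ℝ × ℝ | 0 < p.1 ∧ p.1 < p.2}.indicator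
          (fun p => ENNReal.ofReal (p.1 ^ n)) p) * h p.2 := by
      ext ⟨r, u⟩
      simp [Set.indicator]
    rw [this]
    refine Measurable.mul (Measurable.indicator (by fun_prop) ?_) (by fun_prop)
    exact (measurableSet_lt measurable_const measurable_fst).inter
      (measurableSet_lt measurable_fst measurable_snd)
  have h2 : ∀ u ∈ Set.Ioi (0 : ℝ), ∫⁻ r in Set.Ioi (0 : ℝ),
      (Set.Ioo 0 u).indicator (fun r => ENNReal.ofReal (r ^ n)) r * h u =
      (Set.Ioo (0 : ℝ) 1).indicator
        (fun u => ENNReal.ofReal ((n + 1 : ℝ)⁻¹) *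
          ENNReal.ofReal (u ^ (n + m + 1) * (1 - u) ^ k)) u := by
    intro u hu
    have hu : (0 : ℝ) < u := hu
    rw [lintegral_mul_const _ (Measurable.indicator (by fun_prop) measurableSet_Ioo),
      lintegral_indicator measurableSet_Ioo, Measure.restrict_restrict measurableSet_Ioo,
      Set.inter_eq_left.2 (fun x hx => hx.1)]
    have h3 : ∫⁻ r in Set.Ioo 0 u, ENNReal.ofReal (r ^ n) =
        ENNReal.ofReal (u ^ (n + 1) / (n + 1)) := by
      have : ∫ r in (0 : ℝ)..u, r ^ n = u ^ (n + 1) / (n + 1) := by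
        rw [integral_pow]; simp
      rw [← this, intervalIntegral.integral_of_le hu.le, integral_Ioc_eq_integral_Ioo,
        ofReal_integral_eq_lintegral_ofReal]
      · exact ((by fun_prop : Continuous fun u : ℝ => u ^ n).integrableOn_Icc).mono_set
          Set.Ioo_subset_Icc_self
      · filter_upwards [ae_restrict_mem measurableSet_Ioo] with r hr
        exact pow_nonneg hr.1.le n
    rw [h3]
    simp only [hh]
    split_ifs with h1
    · rw [Set.indicator_of_mem (Set.mem_Ioo.2 ⟨hu, h1⟩), ← ENNReal.ofReal_mul (by positivity),
        ← ENNReal.ofReal_mul (by positivity)]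
      congr 1
      field_simp
      ring
    · rw [Set.indicator_of_notMem (fun h => h1 h.2), mul_zero]
  rw [setLIntegral_congr_fun measurableSet_Ioi h2, lintegral_indicator measurableSet_Ioo,
    Measure.restrict_restrict measurableSet_Ioo, Set.inter_eq_left.2 (fun x hx => hx.1),
    lintegral_const_mul _ (by fun_prop), lintegral_pow_mul_one_sub_pow,
    ← ENNReal.ofReal_mul (by positivity)]
  congr 1
  have : n + m + 1 + k + 1 = n + m + k + 2 := by ring
  rw [this]
  field_simp

/-- The integrand of the radial integrals over the unit ball of `ℂ²`, extended by zero. -/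
noncomputable def ballWeight (n m k : ℕ) (v : Fin 2 → ℂ) : ENNReal :=
  if sqNorm v < 1 then ENNReal.ofReal ((‖v 0‖ ^ 2) ^ n * sqNorm v ^ m * (1 - sqNorm v) ^ k) else 0

lemma measurable_ballWeight (n m k : ℕ) : Measurable (ballWeight n m k) := by
  have := continuous_sqNorm
  refine Measurable.ite (measurableSet_lt this.measurable measurable_const) ?_ measurable_const
  apply Measurable.ennreal_ofReal
  apply Continuous.measurable
  fun_prop

lemma lintegral_ballWeight (n m k : ℕ) :
    ∫⁻ v, ballWeight n m k v = ENNReal.ofReal (Real.pi ^ 2 *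
      (((n + m + 1).factorial * k.factorial : ℝ) / ((n + m + k + 2).factorial * (n + 1)))) := by
  set G : ℝ → ℝ → ENNReal := fun r q =>
    if r + q < 1 then ENNReal.ofReal (r ^ n * (r + q) ^ m * (1 - (r + q)) ^ k) else 0 with hG
  have hGm : Measurable (Function.uncurry G) := by
    refine Measurable.ite (measurableSet_lt (by fun_prop) measurable_const) ?_ measurable_const
    fun_prop
  have h0 : ∀ v : Fin 2 → ℂ, ballWeight n m k v = (fun p : ℂ × ℂ => G (‖p.1‖ ^ 2) (‖p.2‖ ^ 2))
      (MeasurableEquiv.finTwoArrow v) := fun v => rfl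
  simp only [h0]
  have hm : Measurable (fun p : ℂ × ℂ => G (‖p.1‖ ^ 2) (‖p.2‖ ^ 2)) :=
    hGm.comp (by fun_prop : Measurable fun p : ℂ × ℂ => (‖p.1‖ ^ 2, ‖p.2‖ ^ 2))
  have h1 := (volume_preserving_finTwoArrow ℂ).lintegral_comp hm
  rw [h1, Measure.volume_eq_prod, lintegral_prod _ hm.aemeasurable]
  have h2 : ∀ z : ℂ, ∫⁻ w : ℂ, G (‖z‖ ^ 2) (‖w‖ ^ 2) =
      ENNReal.ofReal Real.pi * ∫⁻ q in Set.Ioi (0 : ℝ), G (‖z‖ ^ 2) q := fun z =>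
    lintegral_comp_norm_sq (hGm.comp measurable_prodMk_left)
  simp only [h2]
  have h3 : Measurable fun r => ∫⁻ q in Set.Ioi (0 : ℝ), G r q := hGm.lintegral_prod_right
  rw [lintegral_comp_norm_sq (F := fun r => ENNReal.ofReal Real.pi * ∫⁻ q in Set.Ioi (0 : ℝ), G r q)
    (h3.const_mul _), lintegral_const_mul _ h3, lintegral_triangle,
    ← ENNReal.ofReal_mul Real.pi_nonneg, ← ENNReal.ofReal_mul Real.pi_nonneg]
  congr 1
  ring

/-! ### Fibration of the domain over the first row -/

/-- Linear change of variables in `ℂ²`: the real Jacobian of a complex matrix is `|det A|²`. -/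
lemma lintegral_comp_mulVec (A : Matrix (Fin 2) (Fin 2) ℂ) (hA : A.det ≠ 0)
    {F : (Fin 2 → ℂ) → ENNReal} (hF : Measurable F) :
    ENNReal.ofReal (‖A.det‖ ^ 2) * ∫⁻ w, F (A.mulVec w) = ∫⁻ w, F w := by
  set L : (Fin 2 → ℂ) →ₗ[ℝ] (Fin 2 → ℂ) := (Matrix.toLin' A).restrictScalars ℝ with hL
  have hdet : LinearMap.det L = ‖A.det‖ ^ 2 := by
    rw [hL, LinearMap.det_restrictScalars, LinearMap.det_toLin', Algebra.norm_complex_apply,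
      Complex.normSq_eq_norm_sq]
  have hpos : 0 < ‖A.det‖ ^ 2 := by positivity
  have hne : LinearMap.det L ≠ 0 := by rw [hdet]; exact hpos.ne'
  have h1 := Measure.map_linearMap_addHaar_eq_smul_addHaar (volume : Measure (Fin 2 → ℂ)) hne
  have hLm : Measurable L := L.continuous_of_finiteDimensional.measurable
  have h2 : ∫⁻ w, F (A.mulVec w) = ∫⁻ w, F w ∂(Measure.map L volume) := by
    rw [lintegral_map hF hLm]
    rfl
  rw [h2, h1, lintegral_smul_measure, hdet, abs_of_pos (inv_pos.2 hpos), smul_eq_mul, ← mul_assoc,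
    ← ENNReal.ofReal_mul hpos.le, mul_inv_cancel₀ hpos.ne', ENNReal.ofReal_one, one_mul]

/-- For `0 < |v| < 1` a matrix `S` with `S S† = I - v v†`, `v` being regarded as a column: its
columns are the unit vector orthogonal to `v` and `(1 - |v|²)^{1/2}` times the unit vector along `v`. -/
noncomputable def fibreMatrix (v : Fin 2 → ℂ) : Matrix (Fin 2) (Fin 2) ℂ :=
  !![-conj (v 1) / √(sqNorm v), √(1 - sqNorm v) * v 0 / √(sqNorm v);
    conj (v 0) / √(sqNorm v), √(1 - sqNorm v) * v 1 / √(sqNorm v)]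

lemma sqNorm_eq_conj_mul (v : Fin 2 → ℂ) :
    ((sqNorm v : ℝ) : ℂ) = conj (v 0) * v 0 + conj (v 1) * v 1 := by
  unfold sqNorm
  push_cast
  simp only [← Complex.ofReal_pow, sq_norm_eq_conj_mul]

lemma det_fibreMatrix {v : Fin 2 → ℂ} (h0 : 0 < sqNorm v) :
    (fibreMatrix v).det = -(√(1 - sqNorm v) : ℂ) := by
  have hr : ((√(sqNorm v) : ℝ) : ℂ) ≠ 0 := by exact_mod_cast (Real.sqrt_pos.2 h0).ne'
  have hr2 : ((√(sqNorm v) : ℝ) : ℂ) ^ 2 = conj (v 0) * v 0 + conj (v 1) * v 1 := by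
    rw [← sqNorm_eq_conj_mul, ← Complex.ofReal_pow, Real.sq_sqrt h0.le]
  rw [fibreMatrix, Matrix.det_fin_two_of]
  field_simp
  rw [hr2]
  ring

lemma det_fibre {v : Fin 2 → ℂ} (h0 : 0 < sqNorm v) (w : Fin 2 → ℂ) :
    v 0 * (fibreMatrix v).mulVec w 1 - v 1 * (fibreMatrix v).mulVec w 0 = √(sqNorm v) * w 0 := by
  have hr : ((√(sqNorm v) : ℝ) : ℂ) ≠ 0 := by exact_mod_cast (Real.sqrt_pos.2 h0).ne'
  have hr2 : ((√(sqNorm v) : ℝ) : ℂ) ^ 2 = conj (v 0) * v 0 + conj (v 1) * v 1 := by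
    rw [← sqNorm_eq_conj_mul, ← Complex.ofReal_pow, Real.sq_sqrt h0.le]
  simp only [fibreMatrix, Matrix.mulVec, dotProduct, Fin.sum_univ_two, Matrix.of_apply,
    Matrix.cons_val_zero, Matrix.cons_val_one]
  field_simp
  rw [hr2]
  ring

lemma sqNorm_fibre {v : Fin 2 → ℂ} (h0 : 0 < sqNorm v) (h1 : sqNorm v < 1)
    (w : Fin 2 → ℂ) :
    sqNorm ((fibreMatrix v).mulVec w) = ‖w 0‖ ^ 2 + (1 - sqNorm v) * ‖w 1‖ ^ 2 := by
  have hr : ((√(sqNorm v) : ℝ) : ℂ) ≠ 0 := by exact_mod_cast (Real.sqrt_pos.2 h0).ne'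
  have hr2 : ((√(sqNorm v) : ℝ) : ℂ) ^ 2 = conj (v 0) * v 0 + conj (v 1) * v 1 := by
    rw [← sqNorm_eq_conj_mul, ← Complex.ofReal_pow, Real.sq_sqrt h0.le]
  have hs2 : ((√(1 - sqNorm v) : ℝ) : ℂ) ^ 2 = 1 - sqNorm v := by
    rw [← Complex.ofReal_pow, Real.sq_sqrt (by linarith)]; push_cast; rfl
  apply Complex.ofReal_injective
  rw [sqNorm_eq_conj_mul]
  push_cast
  simp only [← Complex.ofReal_pow, sq_norm_eq_conj_mul]
  rw [← hs2]
  simp only [fibreMatrix, Matrix.mulVec, dotProduct, Fin.sum_univ_two, Matrix.of_apply,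
    Matrix.cons_val_zero, Matrix.cons_val_one, map_add, map_mul, map_div₀, map_neg,
    Complex.conj_conj, Complex.conj_ofReal]
  field_simp
  rw [hr2]
  ring

lemma detGap_fibre {v : Fin 2 → ℂ} (h0 : 0 < sqNorm v) (h1 : sqNorm v < 1)
    (w : Fin 2 → ℂ) :
    detGap ![v, (fibreMatrix v).mulVec w] = (1 - sqNorm v) * (1 - sqNorm w) := by
  have hd := det_fibre h0 w
  unfold detGap
  simp only [Matrix.cons_val_zero, Matrix.cons_val_one]
  rw [hd, sqNorm_fibre h0 h1, norm_mul, mul_pow, Complex.norm_real, Real.norm_eq_abs, sq_abs,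
    Real.sq_sqrt h0.le]
  rw [show sqNorm w = ‖w 0‖ ^ 2 + ‖w 1‖ ^ 2 from rfl]
  ring

/-- Integration over the Cartan domain in the coordinates `(v, w) ↦ (v, S_v w)`, where `S_v` is the
square root `fibreMatrix v`: the integral splits into two integrals over the unit ball of `ℂ²`. -/
lemma lintegral_nuMeasure_pow_mul_det_pow {lam : ℕ} (h : 4 ≤ lam) (n m : ℕ) :
    ∫⁻ Z, ENNReal.ofReal ((‖Z 0 0‖ ^ 2) ^ n * (‖Z 0 0 * Z 1 1 - Z 0 1 * Z 1 0‖ ^ 2) ^ m)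
        ∂(nuMeasure lam) =
      ENNReal.ofReal (normConst lam) *
        ((∫⁻ v, ballWeight n m (lam - 3) v) * ∫⁻ w, ballWeight m 0 (lam - 4) w) := by
  set F : MatSpace → ENNReal := cartanDomain.indicator fun Z =>
    ENNReal.ofReal (nuDensity lam Z) *
      ENNReal.ofReal ((‖Z 0 0‖ ^ 2) ^ n * (‖Z 0 0 * Z 1 1 - Z 0 1 * Z 1 0‖ ^ 2) ^ m) with hF
  have hFm : Measurable F := by
    refine Measurable.indicator ?_ measurableSet_cartanDomain
    refine (measurable_nuDensity lam).mul (Measurable.ennreal_ofReal (Continuous.measurable ?_))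
    fun_prop
  rw [lintegral_nuMeasure h (Measurable.ennreal_ofReal (Continuous.measurable (by fun_prop))),
    ← lintegral_indicator measurableSet_cartanDomain]
  change ∫⁻ Z, F Z = _
  set e : MatSpace ≃ᵐ (Fin 2 → ℂ) × (Fin 2 → ℂ) := MeasurableEquiv.finTwoArrow with he
  have hep := (volume_preserving_finTwoArrow (Fin 2 → ℂ)).symm
  have hG : Measurable fun p : (Fin 2 → ℂ) × (Fin 2 → ℂ) => F (e.symm p) :=
    hFm.comp e.symm.measurable
  rw [← hep.lintegral_comp hFm]
  change ∫⁻ p, F (e.symm p) = _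
  rw [Measure.volume_eq_prod, lintegral_prod _ hG.aemeasurable]
  have hes : ∀ v w, e.symm (v, w) = ![v, w] := by
    intro v w
    rw [MeasurableEquiv.symm_apply_eq]
    rfl
  rw [← lintegral_mul_const _ (measurable_ballWeight _ _ _),
    ← lintegral_const_mul _ ((measurable_ballWeight _ _ _).mul_const _)]
  have hv0 : ∀ᵐ v : Fin 2 → ℂ, v ≠ 0 := by
    rw [ae_iff]; simp
  refine lintegral_congr_ae ?_
  filter_upwards [hv0] with v hv
  have hpos : 0 < sqNorm v := sqNorm_pos hv
  by_cases hv1 : sqNorm v < 1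
  · have hs : 0 < 1 - sqNorm v := by linarith
    have hdet := det_fibreMatrix hpos
    have hnd : ‖(fibreMatrix v).det‖ ^ 2 = 1 - sqNorm v := by
      rw [hdet, norm_neg, Complex.norm_real, Real.norm_eq_abs, sq_abs, Real.sq_sqrt hs.le]
    have hne : (fibreMatrix v).det ≠ 0 := by
      intro h
      rw [h] at hnd
      simp at hnd
      linarith
    have hm : Measurable fun w => F (e.symm (v, w)) := hG.comp measurable_prodMk_left
    have hm' : Measurable fun w => F (e.symm (v, (fibreMatrix v).mulVec w)) :=
      hm.comp (Continuous.measurable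
        ((Matrix.toLin' (fibreMatrix v)).continuous_of_finiteDimensional))
    rw [← lintegral_comp_mulVec _ hne hm, hnd,
      ← lintegral_const_mul _ (measurable_ballWeight _ _ _),
      ← lintegral_const_mul _ ((measurable_ballWeight _ _ _).const_mul _),
      ← lintegral_const_mul _ hm']
    refine lintegral_congr fun w => ?_
    rw [hes]
    have hgap := detGap_fibre hpos hv1 w
    have hd := det_fibre hpos w
    have hmem : ![v, (fibreMatrix v).mulVec w] ∈ cartanDomain ↔ sqNorm w < 1 := by
      rw [mem_cartanDomain_iff, hgap]
      simp only [Matrix.cons_val_zero, hv1, true_and]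
      rw [mul_pos_iff_of_pos_left hs]
      constructor <;> intro h <;> linarith
    simp only [hF, ballWeight, hv1, if_true]
    by_cases hw : sqNorm w < 1
    · rw [Set.indicator_of_mem (hmem.2 hw), if_pos hw]
      simp only [nuDensity, Matrix.cons_val_zero, Matrix.cons_val_one]
      rw [hgap, hd, norm_mul, Complex.norm_real, Real.norm_eq_abs, mul_pow (|√(sqNorm v)|), sq_abs,
        Real.sq_sqrt hpos.le]
      have hc := normConst_pos h
      have hw' : 0 ≤ 1 - sqNorm w := by linarith
      have hl : lam - 3 = (lam - 4) + 1 := by omega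
      rw [← ENNReal.ofReal_mul (by positivity), ← ENNReal.ofReal_mul (by positivity),
        ← ENNReal.ofReal_mul (by positivity), ← ENNReal.ofReal_mul (by positivity), hl,
        mul_pow (1 - sqNorm v)]
      congr 1
      ring
    · rw [Set.indicator_of_notMem (fun h => hw (hmem.1 h)), if_neg hw]
      simp
  · have : ∀ w, F (e.symm (v, w)) = 0 := by
      intro w
      rw [hes]
      apply Set.indicator_of_notMem
      intro h
      exact hv1 ((mem_cartanDomain_iff _).1 h).1
    simp [this, ballWeight, hv1]

/-- The radial normalization constant of `φ^{n/2,m}`. -/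
noncomputable def radialConst (lam n m : ℕ) : ℝ :=
  ((n : ℝ) + 1) / ((lam : ℝ) - 1) * ((m + lam - 2).choose (lam - 2) : ℝ) *
    ((m + n + lam - 1).choose (lam - 2) : ℝ)

lemma radialConst_pos {lam : ℕ} (h : 4 ≤ lam) (n m : ℕ) : 0 < radialConst lam n m := by
  have h' : (4 : ℝ) ≤ lam := by exact_mod_cast h
  have h1 : (0 : ℝ) < lam - 1 := by linarith
  have h2 : 0 < (m + lam - 2).choose (lam - 2) := Nat.choose_pos (by omega)
  have h3 : 0 < (m + n + lam - 1).choose (lam - 2) := Nat.choose_pos (by omega)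
  unfold radialConst
  positivity

/-- The norm of the highest weight vector `z₁₁ⁿ det(Z)ᵐ`. -/
lemma lintegral_nuMeasure_highestWeight {lam : ℕ} (h : 4 ≤ lam) (n m : ℕ) :
    ∫⁻ Z, ENNReal.ofReal ((‖Z 0 0‖ ^ 2) ^ n * (‖Z 0 0 * Z 1 1 - Z 0 1 * Z 1 0‖ ^ 2) ^ m)
        ∂(nuMeasure lam) = ENNReal.ofReal ((radialConst lam n m)⁻¹) := by
  rw [lintegral_nuMeasure_pow_mul_det_pow h, lintegral_ballWeight, lintegral_ballWeight,
    ← ENNReal.ofReal_mul (by positivity), ← ENNReal.ofReal_mul (normConst_pos h).le]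
  congr 1
  obtain ⟨l, rfl⟩ := Nat.exists_eq_add_of_le h
  unfold radialConst normConst
  have e1 : 4 + l - 3 = l + 1 := by omega
  have e2 : 4 + l - 4 = l := by omega
  have e3 : 4 + l - 2 = l + 2 := by omega
  have e4 : m + (4 + l) - 2 = m + (l + 2) := by omega
  have e5 : m + n + (4 + l) - 1 = (m + n + 1) + (l + 2) := by omega
  rw [e1, e2, e3, e4, e5, Nat.add_choose, Nat.add_choose,
    Nat.cast_div (Nat.factorial_mul_factorial_dvd_factorial_add _ _) (by positivity),
    Nat.cast_div (Nat.factorial_mul_factorial_dvd_factorial_add _ _) (by positivity)]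
  have e6 : n + m + (l + 1) + 2 = m + n + 1 + (l + 2) := by omega
  have e7 : m + 0 + l + 2 = m + (l + 2) := by omega
  have e8 : n + m + 1 = m + n + 1 := by omega
  rw [e6, e7, e8, show m + 0 + 1 = m + 1 from rfl]
  have f1 : ((l + 2).factorial : ℝ) = (l + 2) * ((l + 1) * l.factorial) := by
    rw [Nat.factorial_succ, Nat.factorial_succ]; push_cast; ring
  have f2 : ((l + 1).factorial : ℝ) = (l + 1) * l.factorial := by
    rw [Nat.factorial_succ]; push_cast; ring
  have f3 : ((m + 1).factorial : ℝ) = (m + 1) * m.factorial := by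
    rw [Nat.factorial_succ]; push_cast; ring
  push_cast
  rw [f1, f2, f3]
  have hπ := Real.pi_pos
  have g1 : (4 + (l : ℝ) - 1) = l + 3 := by ring
  have g2 : (4 + (l : ℝ) - 2) = l + 2 := by ring
  have g3 : (4 + (l : ℝ) - 3) = l + 1 := by ring
  rw [g1, g2, g3]
  field_simp

/-! ### The generating function of the Wigner matrices -/

/-- The bilinear pairing `αᵀ Z β`. -/
noncomputable def pairing (α β : Fin 2 → ℂ) (Z : MatSpace) : ℂ :=
  β 0 * (α 0 * Z 0 0 + α 1 * Z 1 0) + β 1 * (α 0 * Z 0 1 + α 1 * Z 1 1)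

/-- The sum in the definition of `wignerD`, that is, the coefficient of `x ^ a y ^ (n - a)` in
`(z₁₁ x + z₂₁ y) ^ b (z₁₂ x + z₂₂ y) ^ (n - b)`. -/
noncomputable def wignerSum (n a b : ℕ) (X : MatSpace) : ℂ :=
  ∑ k ∈ Finset.Icc (a + b - n) (min a b),
      (b.choose k : ℂ) * ((n - b).choose (k + n - (a + b)) : ℂ) *
        X 0 0 ^ k * X 0 1 ^ (a - k) * X 1 0 ^ (b - k) * X 1 1 ^ (k + n - (a + b))

lemma pow_mul_pow_eq_sum_wignerSum {n b : ℕ} (hb : b ≤ n) (x y : ℂ) (Z : MatSpace) :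
    (x * Z 0 0 + y * Z 1 0) ^ b * (x * Z 0 1 + y * Z 1 1) ^ (n - b) =
      ∑ a ∈ Finset.range (n + 1), wignerSum n a b Z * (x ^ a * y ^ (n - a)) := by
  rw [add_pow, add_pow, Finset.sum_mul_sum]
  simp only [wignerSum, Finset.sum_mul]
  rw [Finset.sum_sigma', Finset.sum_sigma']
  refine Finset.sum_bij' (fun p _ => ⟨p.1 + p.2, p.1⟩) (fun p _ => ⟨p.2, p.1 - p.2⟩) ?_ ?_ ?_ ?_ ?_
  · rintro ⟨k, l⟩ h
    simp only [Finset.mem_sigma, Finset.mem_range, Finset.mem_Icc, le_min_iff] at h ⊢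
    omega
  · rintro ⟨a, k⟩ h
    simp only [Finset.mem_sigma, Finset.mem_range, Finset.mem_Icc, le_min_iff] at h ⊢
    omega
  · rintro ⟨k, l⟩ h
    simp
  · rintro ⟨a, k⟩ h
    simp only [Finset.mem_sigma, Finset.mem_range, Finset.mem_Icc, le_min_iff] at h
    have : k + (a - k) = a := by omega
    simp [this]
  · rintro ⟨k, l⟩ h
    simp only [Finset.mem_sigma, Finset.mem_range] at h
    have e1 : k + n - (k + l + b) = n - b - l := by omega
    have e2 : k + l - k = l := by omega
    have e3 : n - (k + l) = (b - k) + (n - b - l) := by omega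
    simp only [e1, e2, e3]
    rw [Nat.choose_symm (by omega : l ≤ n - b)]
    simp only [mul_pow, pow_add]
    ring

lemma sqrt_choose_mul_wignerD {n a b : ℕ} (ha : a ≤ n) (hb : b ≤ n) (Z : MatSpace) :
    (√(n.choose a : ℝ) : ℂ) * (√(n.choose b : ℝ) : ℂ) * wignerD n a b Z =
      (n.choose b : ℂ) * wignerSum n a b Z := by
  unfold wignerD
  change _ * (_ * wignerSum n a b Z) = _
  rw [← mul_assoc, ← Complex.ofReal_mul, ← Complex.ofReal_mul]
  congr 1
  rw [← Real.sqrt_mul (by positivity), ← Real.sqrt_mul (by positivity)]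
  have : ((n.choose a : ℝ) * (n.choose b) * (((a.factorial * (n - a).factorial : ℕ) : ℝ) /
      ((b.factorial * (n - b).factorial : ℕ) : ℝ))) = (n.choose b : ℝ) ^ 2 := by
    have h1 : ((n.choose a * a.factorial * (n - a).factorial : ℕ) : ℝ) = n.factorial := by
      rw [Nat.choose_mul_factorial_mul_factorial ha]
    have h2 : ((n.choose b * b.factorial * (n - b).factorial : ℕ) : ℝ) = n.factorial := by
      rw [Nat.choose_mul_factorial_mul_factorial hb]
    have h3 : ((b.factorial * (n - b).factorial : ℕ) : ℝ) ≠ 0 := by positivity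
    field_simp
    push_cast at h1 h2 ⊢
    linear_combination (n.choose b : ℝ) * (h1 - h2)
  rw [this, Real.sqrt_sq (by positivity), Complex.ofReal_natCast]

/-- The powers `(αᵀ Z β)ⁿ` generate the Wigner matrix elements. -/
lemma pairing_pow (n : ℕ) (α β : Fin 2 → ℂ) (Z : MatSpace) :
    pairing α β Z ^ n = ∑ a : Fin (n + 1), ∑ b : Fin (n + 1),
      (√(n.choose a : ℝ) : ℂ) * (√(n.choose b : ℝ) : ℂ) * wignerD n a b Z *
        (α 0 ^ (a : ℕ) * α 1 ^ (n - a) * (β 0 ^ (b : ℕ) * β 1 ^ (n - b))) := by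
  rw [Finset.sum_comm]
  have h1 : ∀ b : Fin (n + 1), ∑ a : Fin (n + 1),
      (√(n.choose a : ℝ) : ℂ) * (√(n.choose b : ℝ) : ℂ) * wignerD n a b Z *
        (α 0 ^ (a : ℕ) * α 1 ^ (n - a) * (β 0 ^ (b : ℕ) * β 1 ^ (n - b))) =
      (β 0 * (α 0 * Z 0 0 + α 1 * Z 1 0)) ^ (b : ℕ) *
        (β 1 * (α 0 * Z 0 1 + α 1 * Z 1 1)) ^ (n - b) * (n.choose b : ℂ) := by
    intro b
    have hb : (b : ℕ) ≤ n := Nat.lt_succ_iff.1 b.2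
    rw [mul_pow, mul_pow]
    have := pow_mul_pow_eq_sum_wignerSum hb (α 0) (α 1) Z
    calc _ = ∑ a : Fin (n + 1), (n.choose b : ℂ) * (β 0 ^ (b : ℕ) * β 1 ^ (n - b)) *
          (wignerSum n a b Z * (α 0 ^ (a : ℕ) * α 1 ^ (n - a))) := by
          refine Finset.sum_congr rfl fun a _ => ?_
          rw [sqrt_choose_mul_wignerD (Nat.lt_succ_iff.1 a.2) hb]
          ring
      _ = (n.choose b : ℂ) * (β 0 ^ (b : ℕ) * β 1 ^ (n - b)) *
          ((α 0 * Z 0 0 + α 1 * Z 1 0) ^ (b : ℕ) * (α 0 * Z 0 1 + α 1 * Z 1 1) ^ (n - b)) := by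
          rw [this, ← Finset.mul_sum, Finset.sum_range (n := n + 1)]
      _ = _ := by ring
  simp only [h1]
  unfold pairing
  rw [add_pow, Finset.sum_range]

lemma continuous_wignerD (n a b : ℕ) : Continuous (wignerD n a b) := by
  unfold wignerD
  fun_prop

lemma wignerD_self (n : ℕ) (Z : MatSpace) : wignerD n n n Z = Z 0 0 ^ n := by
  unfold wignerD
  have h1 : ((n.factorial * (n - n).factorial : ℕ) : ℝ) ≠ 0 := by positivity
  have h2 : n + n - n = n := by omega
  rw [div_self h1, h2]
  simp

/-! ### Weights -/

/-- The functions `det(Z)ᵐ D_{ab}(Z)`: the basis functions without their normalization. -/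
noncomputable def detWigner (n m a b : ℕ) (Z : MatSpace) : ℂ :=
  (Matrix.of Z).det ^ m * wignerD n a b Z

lemma continuous_det : Continuous fun Z : MatSpace => (Matrix.of Z).det := by
  simp only [Matrix.det_fin_two, Matrix.of_apply]
  fun_prop

lemma continuous_detWigner (n m a b : ℕ) : Continuous (detWigner n m a b) :=
  (continuous_det.pow m).mul (continuous_wignerD n a b)

lemma det_biMul (U V : Matrix (Fin 2) (Fin 2) ℂ) (Z : MatSpace) :
    (Matrix.of (biMul U V Z)).det = U.det * V.det * (Matrix.of Z).det := by
  rw [biMul_apply, Matrix.det_mul, Matrix.det_mul]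
  ring

lemma biMul_diagonal (c d : Fin 2 → ℂ) (Z : MatSpace) (i j : Fin 2) :
    biMul (Matrix.diagonal c) (Matrix.diagonal d) Z i j = c i * Z i j * d j := by
  change (Matrix.diagonal c * Matrix.of Z * Matrix.diagonal d) i j = _
  rw [Matrix.mul_diagonal, Matrix.diagonal_mul, Matrix.of_apply]

/-- `det(Z)ᵐ D_{ab}(Z)` is a weight vector for the two diagonal tori. -/
lemma detWigner_biMul_diagonal {n m a b : ℕ} (ha : a ≤ n) (hb : b ≤ n) (c d : Fin 2 → ℂ)
    (Z : MatSpace) :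
    detWigner n m a b (biMul (Matrix.diagonal c) (Matrix.diagonal d) Z) =
      c 0 ^ (m + a) * c 1 ^ (m + (n - a)) * (d 0 ^ (m + b) * d 1 ^ (m + (n - b))) *
        detWigner n m a b Z := by
  unfold detWigner
  rw [det_biMul, Matrix.det_diagonal, Matrix.det_diagonal, Fin.prod_univ_two, Fin.prod_univ_two]
  have : wignerD n a b (biMul (Matrix.diagonal c) (Matrix.diagonal d) Z) =
      c 0 ^ a * c 1 ^ (n - a) * (d 0 ^ b * d 1 ^ (n - b)) * wignerD n a b Z := by
    unfold wignerD
    simp only [biMul_diagonal]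
    rw [mul_left_comm]
    congr 1
    rw [Finset.mul_sum]
    refine Finset.sum_congr rfl fun k hk => ?_
    simp only [Finset.mem_Icc, le_min_iff] at hk
    have e1 : c 0 ^ a = c 0 ^ k * c 0 ^ (a - k) := by rw [← pow_add]; congr 1; omega
    have e2 : c 1 ^ (n - a) = c 1 ^ (b - k) * c 1 ^ (k + n - (a + b)) := by
      rw [← pow_add]; congr 1; omega
    have e3 : d 0 ^ b = d 0 ^ k * d 0 ^ (b - k) := by rw [← pow_add]; congr 1; omega
    have e4 : d 1 ^ (n - b) = d 1 ^ (a - k) * d 1 ^ (k + n - (a + b)) := by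
      rw [← pow_add]; congr 1; omega
    rw [e1, e2, e3, e4]
    simp only [mul_pow]
    ring
  rw [this]
  simp only [mul_pow, pow_add]
  ring

lemma integral_comp_biMul {lam : ℕ} (h : 4 ≤ lam) {U V : Matrix (Fin 2) (Fin 2) ℂ}
    (hU : U.conjTranspose * U = 1) (hV : V * V.conjTranspose = 1) {g : MatSpace → ℂ}
    (hg : Continuous g) :
    ∫ Z, g (biMul U V Z) ∂(nuMeasure lam) = ∫ Z, g Z ∂(nuMeasure lam) := by
  have hp := measurePreserving_biMul h hU hV
  have := integral_map hp.measurable.aemeasurable (f := g) (μ := nuMeasure lam)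
    hg.aestronglyMeasurable
  rw [← this, hp.map_eq]

/-- A function of nonzero weight `q - p` for a circle acting by unitary matrices has integral `0`. -/
lemma integral_eq_zero_of_weight {lam : ℕ} (h : 4 ≤ lam) {g : MatSpace → ℂ} (hg : Continuous g)
    {p q : ℕ} (hpq : p ≠ q) (U V : ℂ → Matrix (Fin 2) (Fin 2) ℂ)
    (hU : ∀ w : ℂ, ‖w‖ = 1 → (U w).conjTranspose * U w = 1)
    (hV : ∀ w : ℂ, ‖w‖ = 1 → V w * (V w).conjTranspose = 1)
    (hw : ∀ w : ℂ, ‖w‖ = 1 → ∀ Z, g (biMul (U w) (V w) Z) = conj w ^ p * w ^ q * g Z) :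
    ∫ Z, g Z ∂(nuMeasure lam) = 0 := by
  obtain ⟨w, hw1, hne⟩ : ∃ w : ℂ, ‖w‖ = 1 ∧ conj w ^ p * w ^ q = -1 := by
    -- a root of unity `w` with `w ^ |q - p| = -1`
    have key : ∀ N : ℕ, N ≠ 0 → ∃ w : ℂ, ‖w‖ = 1 ∧ w ^ N = -1 ∧ conj w * w = 1 := by
      intro N hN
      have h1 : ‖Complex.exp ((Real.pi / N : ℝ) * Complex.I)‖ = 1 :=
        Complex.norm_exp_ofReal_mul_I _
      refine ⟨_, h1, ?_, ?_⟩
      · rw [← Complex.exp_nat_mul, ← Complex.exp_pi_mul_I]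
        congr 1
        have : (N : ℂ) ≠ 0 := by exact_mod_cast hN
        push_cast
        field_simp
      · rw [← sq_norm_eq_conj_mul, h1]; simp
    rcases lt_or_gt_of_ne hpq with hlt | hlt
    · obtain ⟨w, h1, h2, h3⟩ := key (q - p) (by omega)
      refine ⟨w, h1, ?_⟩
      rw [show q = p + (q - p) by omega, pow_add, ← mul_assoc, ← mul_pow, h3, h2]
      simp
    · obtain ⟨w, h1, h2, h3⟩ := key (p - q) (by omega)
      refine ⟨w, h1, ?_⟩
      rw [show p = (p - q) + q by omega, pow_add, mul_assoc, ← mul_pow, h3, ← map_pow, h2]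
      simp
  have h1 := integral_comp_biMul h (hU w hw1) (hV w hw1) hg
  simp only [hw w hw1, hne, integral_const_mul] at h1
  linear_combination (-1 / 2 : ℂ) * h1

lemma diagonal_conjTranspose_mul_self {c : Fin 2 → ℂ} (hc : ∀ i, ‖c i‖ = 1) :
    (Matrix.diagonal c).conjTranspose * Matrix.diagonal c = 1 := by
  rw [Matrix.diagonal_conjTranspose, Matrix.diagonal_mul_diagonal, ← Matrix.diagonal_one]
  congr 1
  ext i
  have := sq_norm_eq_conj_mul (c i)
  rw [hc] at this
  simpa using this.symm

lemma diagonal_mul_conjTranspose_self {c : Fin 2 → ℂ} (hc : ∀ i, ‖c i‖ = 1) :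
    Matrix.diagonal c * (Matrix.diagonal c).conjTranspose = 1 :=
  mul_eq_one_comm.1 (diagonal_conjTranspose_mul_self hc)

/-- Orthogonality of the functions `det(Z)ᵐ D_{ab}(Z)` of different weights. -/
lemma weights_eq_of_integral_ne_zero {lam : ℕ} (h : 4 ≤ lam) {n m a b n' m' a' b' : ℕ}
    (ha : a ≤ n) (hb : b ≤ n) (ha' : a' ≤ n') (hb' : b' ≤ n')
    (hne : ∫ Z, conj (detWigner n m a b Z) * detWigner n' m' a' b' Z ∂(nuMeasure lam) ≠ 0) :
    m + a = m' + a' ∧ m + (n - a) = m' + (n' - a') ∧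
      m + b = m' + b' ∧ m + (n - b) = m' + (n' - b') := by
  have hg : Continuous fun Z => conj (detWigner n m a b Z) * detWigner n' m' a' b' Z :=
    (Complex.continuous_conj.comp (continuous_detWigner _ _ _ _)).mul (continuous_detWigner _ _ _ _)
  have hone : ∀ i : Fin 2, ‖(![1, 1] : Fin 2 → ℂ) i‖ = 1 := by
    intro i; fin_cases i <;> simp
  have hl : ∀ w : ℂ, ‖w‖ = 1 → ∀ i : Fin 2, ‖(![w, 1] : Fin 2 → ℂ) i‖ = 1 := by
    intro w hw i; fin_cases i <;> simp [hw]
  have hr : ∀ w : ℂ, ‖w‖ = 1 → ∀ i : Fin 2, ‖(![1, w] : Fin 2 → ℂ) i‖ = 1 := by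
    intro w hw i; fin_cases i <;> simp [hw]
  refine ⟨?_, ?_, ?_, ?_⟩ <;> by_contra hpq <;> apply hne
  · refine integral_eq_zero_of_weight h hg hpq (fun w => Matrix.diagonal ![w, 1])
      (fun _ => Matrix.diagonal ![1, 1]) (fun w hw => diagonal_conjTranspose_mul_self (hl w hw))
      (fun w hw => diagonal_mul_conjTranspose_self hone) fun w hw Z => ?_
    rw [detWigner_biMul_diagonal ha hb, detWigner_biMul_diagonal ha' hb']
    simp
    ring
  · refine integral_eq_zero_of_weight h hg hpq (fun w => Matrix.diagonal ![1, w])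
      (fun _ => Matrix.diagonal ![1, 1]) (fun w hw => diagonal_conjTranspose_mul_self (hr w hw))
      (fun w hw => diagonal_mul_conjTranspose_self hone) fun w hw Z => ?_
    rw [detWigner_biMul_diagonal ha hb, detWigner_biMul_diagonal ha' hb']
    simp
    ring
  · refine integral_eq_zero_of_weight h hg hpq (fun _ => Matrix.diagonal ![1, 1])
      (fun w => Matrix.diagonal ![w, 1]) (fun w hw => diagonal_conjTranspose_mul_self hone)
      (fun w hw => diagonal_mul_conjTranspose_self (hl w hw)) fun w hw Z => ?_
    rw [detWigner_biMul_diagonal ha hb, detWigner_biMul_diagonal ha' hb']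
    simp
    ring
  · refine integral_eq_zero_of_weight h hg hpq (fun _ => Matrix.diagonal ![1, 1])
      (fun w => Matrix.diagonal ![1, w]) (fun w hw => diagonal_conjTranspose_mul_self hone)
      (fun w hw => diagonal_mul_conjTranspose_self (hr w hw)) fun w hw Z => ?_
    rw [detWigner_biMul_diagonal ha hb, detWigner_biMul_diagonal ha' hb']
    simp
    ring

/-! ### Orthogonality relations -/

/-- The generating function `det(Z)ᵐ (αᵀ Z β)ⁿ`. -/
noncomputable def detPairing (n m : ℕ) (α β : Fin 2 → ℂ) (Z : MatSpace) : ℂ :=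
  (Matrix.of Z).det ^ m * pairing α β Z ^ n

lemma continuous_detPairing (n m : ℕ) (α β : Fin 2 → ℂ) : Continuous (detPairing n m α β) := by
  have := continuous_det
  unfold detPairing pairing
  fun_prop

/-- The coefficient of `det(Z)ᵐ D_{ab}(Z)` in the generating function `det(Z)ᵐ (αᵀ Z β)ⁿ`. -/
noncomputable def genCoeff (n : ℕ) (α β : Fin 2 → ℂ) (a b : ℕ) : ℂ :=
  (√(n.choose a : ℝ) : ℂ) * (√(n.choose b : ℝ) : ℂ) *
    (α 0 ^ a * α 1 ^ (n - a) * (β 0 ^ b * β 1 ^ (n - b)))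

lemma detPairing_eq_sum (n m : ℕ) (α β : Fin 2 → ℂ) (Z : MatSpace) :
    detPairing n m α β Z = ∑ a : Fin (n + 1), ∑ b : Fin (n + 1),
      genCoeff n α β a b * detWigner n m a b Z := by
  unfold detPairing detWigner genCoeff
  rw [pairing_pow, Finset.mul_sum]
  refine Finset.sum_congr rfl fun a _ => ?_
  rw [Finset.mul_sum]
  refine Finset.sum_congr rfl fun b _ => ?_
  ring

lemma Continuous.integrable_nuMeasure {lam : ℕ} (h : 4 ≤ lam) {f : MatSpace → ℂ}
    (hf : Continuous f) : Integrable f (nuMeasure lam) :=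
  memLp_one_iff_integrable.1 (Continuous.memLp_nuMeasure h hf 1)

lemma continuous_conj_mul {f g : MatSpace → ℂ} (hf : Continuous f) (hg : Continuous g) :
    Continuous fun Z => conj (f Z) * g Z :=
  (Complex.continuous_conj.comp hf).mul hg

lemma integral_conj_detWigner_self {lam : ℕ} (h : 4 ≤ lam) (n m : ℕ) :
    ∫ Z, conj (detWigner n m n n Z) * detWigner n m n n Z ∂(nuMeasure lam) =
      (((radialConst lam n m)⁻¹ : ℝ) : ℂ) := by
  have h1 : ∀ Z, conj (detWigner n m n n Z) * detWigner n m n n Z =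
      (((‖Z 0 0‖ ^ 2) ^ n * (‖Z 0 0 * Z 1 1 - Z 0 1 * Z 1 0‖ ^ 2) ^ m : ℝ) : ℂ) := by
    intro Z
    rw [← sq_norm_eq_conj_mul]
    congr 1
    rw [detWigner, wignerD_self, Matrix.det_fin_two, norm_mul, norm_pow, norm_pow]
    simp only [Matrix.of_apply]
    ring
  simp only [h1]
  rw [integral_complex_ofReal, integral_eq_lintegral_of_nonneg_ae,
    lintegral_nuMeasure_highestWeight h,
    ENNReal.toReal_ofReal (inv_nonneg.2 (radialConst_pos h n m).le)]
  · exact Filter.Eventually.of_forall fun Z => by positivity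
  · exact Continuous.aestronglyMeasurable (by fun_prop)

/-- Only one weight of `det(Z)^{m'} (αᵀ Z β)^{n'}` is the highest weight of `det(Z)ᵐ z₁₁ⁿ`. -/
lemma integral_conj_highestWeight_mul_detPairing {lam : ℕ} (h : 4 ≤ lam) (n m n' m' : ℕ)
    (hm : m ≤ m') (α β : Fin 2 → ℂ) :
    ∫ Z, conj (detWigner n m n n Z) * detPairing n' m' α β Z ∂(nuMeasure lam) =
      if n = n' ∧ m = m' then α 0 ^ n * β 0 ^ n * (((radialConst lam n m)⁻¹ : ℝ) : ℂ) else 0 := by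
  simp only [detPairing_eq_sum, Finset.mul_sum]
  have hint : ∀ a b : ℕ, Integrable (fun Z => conj (detWigner n m n n Z) *
      (genCoeff n' α β a b * detWigner n' m' a b Z)) (nuMeasure lam) := fun a b =>
    Continuous.integrable_nuMeasure h (continuous_conj_mul (continuous_detWigner _ _ _ _)
      ((continuous_detWigner _ _ _ _).const_mul _))
  have h0 : ∫ Z, ∑ a : Fin (n' + 1), ∑ b : Fin (n' + 1), conj (detWigner n m n n Z) *
      (genCoeff n' α β a b * detWigner n' m' a b Z) ∂(nuMeasure lam) =
      ∑ a : Fin (n' + 1), ∫ Z, ∑ b : Fin (n' + 1), conj (detWigner n m n n Z) *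
      (genCoeff n' α β a b * detWigner n' m' a b Z) ∂(nuMeasure lam) :=
    integral_finsetSum _ fun a _ => integrable_finsetSum _ fun b _ => hint a b
  have h1 : ∀ a b : ℕ, ∫ Z, conj (detWigner n m n n Z) *
      (genCoeff n' α β a b * detWigner n' m' a b Z) ∂(nuMeasure lam) =
      genCoeff n' α β a b *
        ∫ Z, conj (detWigner n m n n Z) * detWigner n' m' a b Z ∂(nuMeasure lam) := by
    intro a b
    rw [← integral_const_mul]
    congr 1
    ext Z
    ring
  have h2 : ∀ a : Fin (n' + 1), ∫ Z, ∑ b : Fin (n' + 1), conj (detWigner n m n n Z) *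
      (genCoeff n' α β a b * detWigner n' m' a b Z) ∂(nuMeasure lam) =
      ∑ b : Fin (n' + 1), genCoeff n' α β a b *
        ∫ Z, conj (detWigner n m n n Z) * detWigner n' m' a b Z ∂(nuMeasure lam) := by
    intro a
    rw [integral_finsetSum _ fun (b : Fin (n' + 1)) _ => hint a b]
    exact Finset.sum_congr rfl fun b _ => h1 a b
  rw [h0]
  simp only [h2]
  -- a nonzero term forces `m' + (n' - a) = m`, so that `m = m'` and `a = n'`, and so on
  have h3 : ∀ a b : Fin (n' + 1),
      ∫ Z, conj (detWigner n m n n Z) * detWigner n' m' a b Z ∂(nuMeasure lam) ≠ 0 →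
      n = n' ∧ m = m' ∧ a = Fin.last n' ∧ b = Fin.last n' := by
    intro a b hne
    have ha := a.2
    have hb := b.2
    have := weights_eq_of_integral_ne_zero h le_rfl le_rfl (by omega) (by omega) hne
    refine ⟨by omega, by omega, Fin.ext ?_, Fin.ext ?_⟩ <;> rw [Fin.val_last] <;> omega
  split_ifs with hc
  · obtain ⟨rfl, rfl⟩ := hc
    rw [Finset.sum_eq_single (Fin.last n), Finset.sum_eq_single (Fin.last n)]
    · rw [Fin.val_last, integral_conj_detWigner_self h]
      simp [genCoeff]
    · intro b _ hb
      by_contra hne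
      exact hb (h3 _ _ (right_ne_zero_of_mul hne)).2.2.2
    · simp
    · intro a _ ha
      refine Finset.sum_eq_zero fun b _ => ?_
      by_contra hne
      exact ha (h3 _ _ (right_ne_zero_of_mul hne)).2.2.1
    · simp
  · refine Finset.sum_eq_zero fun a _ => Finset.sum_eq_zero fun b _ => ?_
    by_contra hne
    have := h3 _ _ (right_ne_zero_of_mul hne)
    exact hc ⟨this.1, this.2.1⟩

/-- The Hermitian inner product of `ℂ²`. -/
noncomputable def herm (α β : Fin 2 → ℂ) : ℂ := conj (α 0) * β 0 + conj (α 1) * β 1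

/-- A matrix in `SU(2)` whose transpose rotates `α` onto the first axis. -/
lemma exists_unitary_rotation {α : Fin 2 → ℂ} (hα : α ≠ 0) : ∃ (r : ℝ)
    (U : Matrix (Fin 2) (Fin 2) ℂ), r ≠ 0 ∧ U.conjTranspose * U = 1 ∧ U.det = 1 ∧
      α 0 * U 0 0 + α 1 * U 1 0 = r ∧ α 0 * U 0 1 + α 1 * U 1 1 = 0 ∧
      U 0 0 = conj (α 0) / r ∧ U 1 0 = conj (α 1) / r := by
  have hpos : 0 < sqNorm α := sqNorm_pos hα
  have hr : ((√(sqNorm α) : ℝ) : ℂ) ≠ 0 := by exact_mod_cast (Real.sqrt_pos.2 hpos).ne'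
  have hr2 : ((√(sqNorm α) : ℝ) : ℂ) ^ 2 = conj (α 0) * α 0 + conj (α 1) * α 1 := by
    rw [← sqNorm_eq_conj_mul, ← Complex.ofReal_pow, Real.sq_sqrt hpos.le]
  refine ⟨√(sqNorm α), !![conj (α 0) / √(sqNorm α), -α 1 / √(sqNorm α);
    conj (α 1) / √(sqNorm α), α 0 / √(sqNorm α)], (Real.sqrt_pos.2 hpos).ne', ?_, ?_, ?_, ?_,
    rfl, rfl⟩
  · ext i j
    fin_cases i <;> fin_cases j <;>
      simp [Matrix.mul_apply, Fin.sum_univ_two] <;> field_simp <;> (try rw [hr2]) <;> ring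
  · rw [Matrix.det_fin_two_of]
    field_simp
    rw [hr2]
    ring
  · simp
    field_simp
    rw [hr2]
    ring
  · simp
    field_simp
    ring

lemma pairing_biMul (U V : Matrix (Fin 2) (Fin 2) ℂ) (α β : Fin 2 → ℂ) (Z : MatSpace) :
    pairing α β (biMul U V Z) =
      pairing ![α 0 * U 0 0 + α 1 * U 1 0, α 0 * U 0 1 + α 1 * U 1 1]
        ![V 0 0 * β 0 + V 0 1 * β 1, V 1 0 * β 0 + V 1 1 * β 1] Z := by
  have : ∀ i j, biMul U V Z i j = (U i 0 * Z 0 0 + U i 1 * Z 1 0) * V 0 j +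
      (U i 0 * Z 0 1 + U i 1 * Z 1 1) * V 1 j := by
    intro i j
    change (U * Matrix.of Z * V) i j = _
    simp [Matrix.mul_apply, Fin.sum_univ_two]
  simp only [pairing, this, Matrix.cons_val_zero, Matrix.cons_val_one]
  ring

/-- Rotating `α` and `β` onto the first axis reduces the inner product of two generating functions
to one against a highest weight vector. -/
lemma integral_conj_detPairing_of_le {lam : ℕ} (h : 4 ≤ lam) (n m n' m' : ℕ) (hm : m ≤ m')
    {α β : Fin 2 → ℂ} (hα : α ≠ 0) (hβ : β ≠ 0) (α' β' : Fin 2 → ℂ) :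
    ∫ Z, conj (detPairing n m α β Z) * detPairing n' m' α' β' Z ∂(nuMeasure lam) =
      if n = n' ∧ m = m' then
        herm α α' ^ n * herm β β' ^ n * (((radialConst lam n m)⁻¹ : ℝ) : ℂ) else 0 := by
  obtain ⟨r, U, hr, hU, hUd, hU0, hU1, hU00, hU10⟩ := exists_unitary_rotation hα
  obtain ⟨s, W, hs, hW, hWd, hW0, hW1, hW00, hW10⟩ := exists_unitary_rotation hβ
  have hV : W.transpose * W.transpose.conjTranspose = 1 := by
    have := congrArg Matrix.transpose hW
    rw [Matrix.transpose_mul, Matrix.transpose_one] at this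
    exact this
  rw [← integral_comp_biMul h hU hV (continuous_conj_mul (continuous_detPairing _ _ _ _)
    (continuous_detPairing _ _ _ _))]
  have h1 : ∀ Z, detPairing n m α β (biMul U W.transpose Z) =
      (r : ℂ) ^ n * (s : ℂ) ^ n * detWigner n m n n Z := by
    intro Z
    unfold detPairing detWigner
    rw [det_biMul, hUd, Matrix.det_transpose, hWd, pairing_biMul, wignerD_self]
    simp only [Matrix.transpose_apply]
    rw [hU0, hU1, mul_comm (W 0 0), mul_comm (W 1 0), mul_comm (W 0 1), mul_comm (W 1 1), hW0, hW1]
    simp only [pairing, Matrix.cons_val_zero, Matrix.cons_val_one]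
    ring
  set α'' : Fin 2 → ℂ := ![α' 0 * U 0 0 + α' 1 * U 1 0, α' 0 * U 0 1 + α' 1 * U 1 1] with hα''
  set β'' : Fin 2 → ℂ := ![W 0 0 * β' 0 + W 1 0 * β' 1, W 0 1 * β' 0 + W 1 1 * β' 1] with hβ''
  have h2 : ∀ Z, detPairing n' m' α' β' (biMul U W.transpose Z) = detPairing n' m' α'' β'' Z := by
    intro Z
    unfold detPairing
    rw [det_biMul, hUd, Matrix.det_transpose, hWd, pairing_biMul]
    simp only [Matrix.transpose_apply, one_mul]
    rfl
  have h3 : ∀ Z, conj (detPairing n m α β (biMul U W.transpose Z)) *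
      detPairing n' m' α' β' (biMul U W.transpose Z) = (r : ℂ) ^ n * (s : ℂ) ^ n *
        (conj (detWigner n m n n Z) * detPairing n' m' α'' β'' Z) := by
    intro Z
    rw [h1, h2]
    simp only [map_mul, map_pow, Complex.conj_ofReal]
    ring
  simp only [h3]
  rw [integral_const_mul, integral_conj_highestWeight_mul_detPairing h n m n' m' hm]
  have hr' : (r : ℂ) ≠ 0 := by exact_mod_cast hr
  have hs' : (s : ℂ) ≠ 0 := by exact_mod_cast hs
  have hα0 : (r : ℂ) * α'' 0 = herm α α' := by
    simp only [hα'', Matrix.cons_val_zero, hU00, hU10, herm]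
    field_simp
  have hβ0 : (s : ℂ) * β'' 0 = herm β β' := by
    simp only [hβ'', Matrix.cons_val_zero, hW00, hW10, herm]
    field_simp
  split_ifs
  · rw [← hα0, ← hβ0, mul_pow, mul_pow]
    ring
  · simp

lemma integral_conj_swap {μ : Measure MatSpace} (f g : MatSpace → ℂ) :
    ∫ Z, conj (f Z) * g Z ∂μ = conj (∫ Z, conj (g Z) * f Z ∂μ) := by
  rw [← integral_conj]
  congr 1
  ext Z
  simp [mul_comm]

/-- The reproducing property of the generating functions. -/
lemma integral_conj_detPairing {lam : ℕ} (h : 4 ≤ lam) (n m n' m' : ℕ)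
    {α β α' β' : Fin 2 → ℂ} (hα : α ≠ 0) (hβ : β ≠ 0) (hα' : α' ≠ 0) (hβ' : β' ≠ 0) :
    ∫ Z, conj (detPairing n m α β Z) * detPairing n' m' α' β' Z ∂(nuMeasure lam) =
      if n = n' ∧ m = m' then
        herm α α' ^ n * herm β β' ^ n * (((radialConst lam n m)⁻¹ : ℝ) : ℂ) else 0 := by
  rcases le_or_gt m m' with hm | hm
  · exact integral_conj_detPairing_of_le h n m n' m' hm hα hβ α' β'
  · rw [integral_conj_swap, integral_conj_detPairing_of_le h n' m' n m hm.le hα' hβ',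
      if_neg (by omega), if_neg (by omega), map_zero]

/-! ### Extraction of coefficients -/

lemma coeff_eq_of_sum_pow_eq {n : ℕ} {c d : Fin (n + 1) → ℂ}
    (h : ∀ x : ℂ, ∑ a, c a * x ^ (a : ℕ) = ∑ a, d a * x ^ (a : ℕ)) : c = d := by
  have h1 : (∑ a : Fin (n + 1), Polynomial.C (c a) * Polynomial.X ^ (a : ℕ)) =
      ∑ a : Fin (n + 1), Polynomial.C (d a) * Polynomial.X ^ (a : ℕ) := by
    apply Polynomial.funext
    intro x
    simpa [Polynomial.eval_finsetSum] using h x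
  ext a
  have h2 := congrArg (fun p => Polynomial.coeff p (a : ℕ)) h1
  simp only [Polynomial.finsetSum_coeff, Polynomial.coeff_C_mul, Polynomial.coeff_X_pow] at h2
  simpa only [mul_ite, mul_one, mul_zero, Fin.val_inj, Finset.sum_ite_eq, Finset.mem_univ,
    if_true] using h2

lemma coeff_eq_of_sum_pow_eq_four {n n' : ℕ}
    {c d : Fin (n + 1) → Fin (n + 1) → Fin (n' + 1) → Fin (n' + 1) → ℂ}
    (h : ∀ x y x' y' : ℂ,
      ∑ a, (∑ b, (∑ a', (∑ b', c a b a' b' * y' ^ (b' : ℕ)) * x' ^ (a' : ℕ)) * y ^ (b : ℕ)) *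
        x ^ (a : ℕ) =
      ∑ a, (∑ b, (∑ a', (∑ b', d a b a' b' * y' ^ (b' : ℕ)) * x' ^ (a' : ℕ)) * y ^ (b : ℕ)) *
        x ^ (a : ℕ)) : c = d := by
  ext a b a' b'
  refine congrFun (coeff_eq_of_sum_pow_eq (c := c a b a') (d := d a b a') fun y' => ?_) b'
  refine congrFun (coeff_eq_of_sum_pow_eq (c := fun a' => ∑ b', c a b a' b' * y' ^ (b' : ℕ))
    (d := fun a' => ∑ b', d a b a' b' * y' ^ (b' : ℕ)) fun x' => ?_) a'
  refine congrFun (coeff_eq_of_sum_pow_eq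
    (c := fun b => ∑ a', (∑ b', c a b a' b' * y' ^ (b' : ℕ)) * x' ^ (a' : ℕ))
    (d := fun b => ∑ a', (∑ b', d a b a' b' * y' ^ (b' : ℕ)) * x' ^ (a' : ℕ)) fun y => ?_) b
  exact congrFun (coeff_eq_of_sum_pow_eq fun x => h x y x' y') a

/-- Orthogonality relations: the coefficients of the reproducing property of the generating
functions, at `α = (x̄, 1)`, `β = (ȳ, 1)`, `α' = (x', 1)`, `β' = (y', 1)`. -/
lemma integral_conj_detWigner {lam : ℕ} (h : 4 ≤ lam) (n m n' m' : ℕ) (a b : Fin (n + 1))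
    (a' b' : Fin (n' + 1)) :
    ∫ Z, conj (detWigner n m a b Z) * detWigner n' m' a' b' Z ∂(nuMeasure lam) =
      if (n = n' ∧ m = m') ∧ (a : ℕ) = a' ∧ (b : ℕ) = b' then
        (((radialConst lam n m)⁻¹ : ℝ) : ℂ) else 0 := by
  set I : Fin (n + 1) → Fin (n + 1) → Fin (n' + 1) → Fin (n' + 1) → ℂ := fun a b a' b' =>
    ∫ Z, conj (detWigner n m a b Z) * detWigner n' m' a' b' Z ∂(nuMeasure lam) with hI
  set s : ℕ → ℕ → ℂ := fun n a => (√(n.choose a : ℝ) : ℂ) with hs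
  have hs2 : ∀ n a, s n a * s n a = (n.choose a : ℂ) := by
    intro n a
    rw [hs]
    simp only
    rw [← Complex.ofReal_mul, Real.mul_self_sqrt (by positivity), Complex.ofReal_natCast]
  have key : (fun (a b : Fin (n + 1)) (a' b' : Fin (n' + 1)) =>
      s n a * s n b * (s n' a' * s n' b') * I a b a' b') =
      fun (a b : Fin (n + 1)) (a' b' : Fin (n' + 1)) =>
        if (n = n' ∧ m = m') ∧ (a : ℕ) = a' ∧ (b : ℕ) = b' then
          (n.choose a : ℂ) * (n.choose b : ℂ) * (((radialConst lam n m)⁻¹ : ℝ) : ℂ) else 0 := by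
    apply coeff_eq_of_sum_pow_eq_four
    intro x y x' y'
    set α : Fin 2 → ℂ := ![conj x, 1]
    set β : Fin 2 → ℂ := ![conj y, 1]
    set α' : Fin 2 → ℂ := ![x', 1]
    set β' : Fin 2 → ℂ := ![y', 1]
    have hne : ∀ z : ℂ, (![z, 1] : Fin 2 → ℂ) ≠ 0 := by
      intro z hz
      simpa using congrFun hz 1
    have hrep := integral_conj_detPairing h n m n' m' (hne (conj x)) (hne (conj y)) (hne x')
      (hne y')
    have hexp : ∀ Z, conj (detPairing n m α β Z) * detPairing n' m' α' β' Z =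
        ∑ a : Fin (n + 1), ∑ b : Fin (n + 1), ∑ a' : Fin (n' + 1), ∑ b' : Fin (n' + 1),
          (s n a * s n b * (s n' a' * s n' b') * (y' ^ (b' : ℕ) * x' ^ (a' : ℕ) * y ^ (b : ℕ) *
            x ^ (a : ℕ))) * (conj (detWigner n m a b Z) * detWigner n' m' a' b' Z) := by
      intro Z
      rw [detPairing_eq_sum, detPairing_eq_sum, map_sum, Finset.sum_mul]
      refine Finset.sum_congr rfl fun a _ => ?_
      rw [map_sum, Finset.sum_mul]
      refine Finset.sum_congr rfl fun b _ => ?_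
      rw [Finset.mul_sum]
      refine Finset.sum_congr rfl fun a' _ => ?_
      rw [Finset.mul_sum]
      refine Finset.sum_congr rfl fun b' _ => ?_
      simp only [genCoeff, map_mul, map_pow, Complex.conj_ofReal, α, β, α', β', hs,
        Matrix.cons_val_zero, Matrix.cons_val_one, one_pow, mul_one, Complex.conj_conj]
      ring
    have hint : ∀ (c : ℂ) (a b a' b' : ℕ), Integrable (fun Z => c *
        (conj (detWigner n m a b Z) * detWigner n' m' a' b' Z)) (nuMeasure lam) :=
      fun c a b a' b' => (Continuous.integrable_nuMeasure h (continuous_conj_mul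
        (continuous_detWigner _ _ _ _) (continuous_detWigner _ _ _ _))).const_mul c
    have hlhs : ∫ Z, conj (detPairing n m α β Z) * detPairing n' m' α' β' Z ∂(nuMeasure lam) =
        ∑ a : Fin (n + 1), (∑ b : Fin (n + 1), (∑ a' : Fin (n' + 1), (∑ b' : Fin (n' + 1),
          s n a * s n b * (s n' a' * s n' b') * I a b a' b' * y' ^ (b' : ℕ)) * x' ^ (a' : ℕ)) *
            y ^ (b : ℕ)) * x ^ (a : ℕ) := by
      simp only [hexp]
      rw [integral_finsetSum Finset.univ fun (a : Fin (n + 1)) _ =>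
        integrable_finsetSum Finset.univ fun (b : Fin (n + 1)) _ =>
        integrable_finsetSum Finset.univ fun (a' : Fin (n' + 1)) _ =>
        integrable_finsetSum Finset.univ fun (b' : Fin (n' + 1)) _ => hint _ a b a' b']
      refine Finset.sum_congr rfl fun a _ => ?_
      rw [integral_finsetSum Finset.univ fun (b : Fin (n + 1)) _ =>
        integrable_finsetSum Finset.univ fun (a' : Fin (n' + 1)) _ =>
        integrable_finsetSum Finset.univ fun (b' : Fin (n' + 1)) _ => hint _ a b a' b',
        Finset.sum_mul]
      refine Finset.sum_congr rfl fun b _ => ?_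
      rw [integral_finsetSum Finset.univ fun (a' : Fin (n' + 1)) _ =>
        integrable_finsetSum Finset.univ fun (b' : Fin (n' + 1)) _ => hint _ a b a' b',
        Finset.sum_mul, Finset.sum_mul]
      refine Finset.sum_congr rfl fun a' _ => ?_
      rw [integral_finsetSum Finset.univ fun (b' : Fin (n' + 1)) _ => hint _ a b a' b',
        Finset.sum_mul, Finset.sum_mul, Finset.sum_mul]
      refine Finset.sum_congr rfl fun b' _ => ?_
      rw [integral_const_mul]
      simp only [hI]
      ring
    rw [← hlhs, hrep]
    by_cases hc : n = n' ∧ m = m'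
    · rw [if_pos hc]
      obtain ⟨rfl, rfl⟩ := hc
      have e1 : herm ![conj x, 1] ![x', 1] = x * x' + 1 := by simp [herm]
      have e2 : herm ![conj y, 1] ![y', 1] = y * y' + 1 := by simp [herm]
      rw [e1, e2, add_pow, add_pow, Finset.sum_range, Finset.sum_range, Finset.sum_mul_sum,
        Finset.sum_mul]
      refine Finset.sum_congr rfl fun a _ => ?_
      rw [Finset.sum_mul, Finset.sum_mul]
      refine Finset.sum_congr rfl fun b _ => ?_
      rw [Finset.sum_eq_single a, Finset.sum_eq_single b]
      · simp only [and_self, if_true, one_pow, mul_one, mul_pow]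
        ring
      · intro b' _ hb
        rw [if_neg (fun hh => hb (Fin.ext hh.2.2.symm)), zero_mul]
      · simp
      · intro a' _ ha
        rw [Finset.sum_eq_zero, zero_mul]
        intro b' _
        rw [if_neg (fun hh => ha (Fin.ext hh.2.1.symm)), zero_mul]
      · simp
    · simp [hc]
  have hk := congrFun (congrFun (congrFun (congrFun key a) b) a') b'
  change I a b a' b' = _
  have hpos : ∀ n (a : Fin (n + 1)), s n a ≠ 0 := by
    intro n a h0
    have h1 := hs2 n a
    rw [h0, zero_mul] at h1
    exact (Nat.choose_pos (Nat.lt_succ_iff.1 a.2)).ne' (by exact_mod_cast h1.symm)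
  have hne : s n a * s n b * (s n' a' * s n' b') ≠ 0 :=
    mul_ne_zero (mul_ne_zero (hpos n a) (hpos n b)) (mul_ne_zero (hpos n' a') (hpos n' b'))
  apply mul_left_cancel₀ hne
  rw [hk]
  split_ifs with hc
  · obtain ⟨⟨rfl, rfl⟩, ha, hb⟩ := hc
    rw [← ha, ← hb, mul_mul_mul_comm, hs2, hs2]
  · simp

lemma basisFun_eq (lam : ℕ) (i : BasisIndex) (Z : MatSpace) :
    basisFun lam i Z =
      (√(radialConst lam i.1.1 i.1.2) : ℂ) * detWigner i.1.1 i.1.2 i.2.1 i.2.2 Z := by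
  unfold basisFun detWigner radialConst
  rw [mul_assoc]

lemma continuous_basisFun (lam : ℕ) (i : BasisIndex) : Continuous (basisFun lam i) := by
  have : basisFun lam i = fun Z => (√(radialConst lam i.1.1 i.1.2) : ℂ) *
      detWigner i.1.1 i.1.2 i.2.1 i.2.2 Z := funext (basisFun_eq lam i)
  rw [this]
  exact (continuous_detWigner _ _ _ _).const_mul _

lemma integral_conj_basisFun {lam : ℕ} (h : 4 ≤ lam) (i i' : BasisIndex) :
    ∫ Z, conj (basisFun lam i Z) * basisFun lam i' Z ∂(nuMeasure lam) =
      if i = i' then 1 else 0 := by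
  obtain ⟨⟨n, m⟩, a, b⟩ := i
  obtain ⟨⟨n', m'⟩, a', b'⟩ := i'
  have h1 : ∀ Z, conj (basisFun lam ⟨(n, m), a, b⟩ Z) * basisFun lam ⟨(n', m'), a', b'⟩ Z =
      (√(radialConst lam n m) : ℂ) * (√(radialConst lam n' m') : ℂ) *
        (conj (detWigner n m a b Z) * detWigner n' m' a' b' Z) := by
    intro Z
    rw [basisFun_eq, basisFun_eq, map_mul, Complex.conj_ofReal]
    ring
  simp only [h1]
  rw [integral_const_mul, integral_conj_detWigner h]
  by_cases hc : (n = n' ∧ m = m') ∧ (a : ℕ) = a' ∧ (b : ℕ) = b'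
  · obtain ⟨⟨rfl, rfl⟩, ha, hb⟩ := hc
    obtain rfl := Fin.ext ha
    obtain rfl := Fin.ext hb
    have hp := radialConst_pos h n m
    rw [if_pos (by simp), if_pos rfl, ← Complex.ofReal_mul, ← Complex.ofReal_mul,
      Real.mul_self_sqrt hp.le, mul_inv_cancel₀ hp.ne', Complex.ofReal_one]
  · rw [if_neg hc, mul_zero, if_neg]
    intro he
    apply hc
    simp only [Sigma.mk.injEq, Prod.mk.injEq] at he
    obtain ⟨⟨rfl, rfl⟩, he⟩ := he
    obtain ⟨rfl, rfl⟩ := Prod.mk.injEq _ _ _ _ ▸ (eq_of_heq he)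
    simp

/-! ### Holomorphic functions of several variables -/

section SeveralVariables

open Metric Filter Topology

variable {E : Type*} [NormedAddCommGroup E] [NormedSpace ℂ E]

lemma norm_fderiv_le_of_forall_norm_le {f : E → ℂ} {c : E} {R M : ℝ} (hR : 0 < R)
    (hd : DifferentiableOn ℂ f (ball c R)) (hM : ∀ z ∈ ball c R, ‖f z‖ ≤ M) :
    ‖fderiv ℂ f c‖ ≤ 2 * M / R := by
  refine Complex.norm_fderiv_le_div_of_mapsTo_ball hd (fun z hz => ?_) hR
  rw [mem_closedBall, dist_eq_norm]
  have h1 := norm_sub_le (f z) (f c)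
  have h2 := hM z hz
  have h3 := hM c (mem_ball_self hR)
  linarith

/-- A locally uniform limit of holomorphic functions of several variables is holomorphic: by the
Cauchy estimates the derivatives converge as well. -/
lemma differentiableAt_of_tendstoUniformlyOn_ball {ι : Type*} {l : Filter ι} [l.NeBot]
    {F : ι → E → ℂ} {g : E → ℂ} {x : E} {r : ℝ} (hr : 0 < r)
    (hd : ∀ n, DifferentiableOn ℂ (F n) (ball x r)) (hF : TendstoUniformlyOn F g l (ball x r)) :
    DifferentiableAt ℂ g x := by
  have hsub : ∀ y ∈ ball x (r / 2), ball y (r / 2) ⊆ ball x r := fun y hy =>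
    ball_subset_ball' (by rw [mem_ball] at hy; linarith)
  have hC : UniformCauchySeqOn (fun n => fderiv ℂ (F n)) l (ball x (r / 2)) := by
    intro u hu
    obtain ⟨ε, hε, hεu⟩ := Metric.mem_uniformity_dist.1 hu
    have h1 := hF.uniformCauchySeqOn _ (Metric.dist_mem_uniformity
      (show 0 < ε * r / 8 by positivity))
    filter_upwards [h1] with p hp y hy
    apply hεu
    have hd1 : DifferentiableAt ℂ (F p.1) y := (hd p.1).differentiableAt
      (isOpen_ball.mem_nhds (hsub y hy (mem_ball_self (by linarith))))
    have hd2 : DifferentiableAt ℂ (F p.2) y := (hd p.2).differentiableAt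
      (isOpen_ball.mem_nhds (hsub y hy (mem_ball_self (by linarith))))
    rw [dist_eq_norm, ← fderiv_sub hd1 hd2]
    have h2 := norm_fderiv_le_of_forall_norm_le (M := ε * r / 8) (half_pos hr)
      (((hd p.1).sub (hd p.2)).mono (hsub y hy)) (fun z hz => by
        have := hp z (hsub y hy hz)
        rw [dist_eq_norm] at this
        exact this.le)
    refine lt_of_le_of_lt h2 ?_
    rw [div_lt_iff₀ (by positivity)]
    nlinarith [mul_pos hε hr]
  have hlim : ∀ y ∈ ball x (r / 2), ∃ L, Tendsto (fun n => fderiv ℂ (F n) y) l (𝓝 L) := by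
    intro y hy
    exact cauchy_map_iff_exists_tendsto.1 (hC.cauchy_map hy)
  choose! G hG using hlim
  have := hasFDerivAt_of_tendstoUniformlyOn isOpen_ball
    (hC.tendstoUniformlyOn_of_tendsto hG)
    (fun n y hy => ((hd n).differentiableAt
      (isOpen_ball.mem_nhds (hsub y hy (mem_ball_self (by linarith))))).hasFDerivAt)
    (fun y hy => hF.tendsto_at (ball_subset_ball (by linarith) hy)) (mem_ball_self (half_pos hr))
  exact this.differentiableAt

/-- Quadratic remainder in the first order Taylor expansion of a bounded holomorphic function. -/
lemma norm_sub_sub_fderiv_le {f : E → ℂ} {c w : E} {R M : ℝ} (hR : 0 < R)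
    (hd : DifferentiableOn ℂ f (ball c R)) (hM : ∀ z ∈ ball c R, ‖f z‖ ≤ M) (hw : ‖w‖ < R) :
    ‖f (c + w) - f c - fderiv ℂ f c w‖ ≤ 4 * M * (‖w‖ / R) ^ 2 := by
  set g : E → ℂ := fun z => f z - fderiv ℂ f c (z - c) with hg
  have hf' := norm_fderiv_le_of_forall_norm_le hR hd hM
  have hfc : DifferentiableAt ℂ f c := hd.differentiableAt (isOpen_ball.mem_nhds (mem_ball_self hR))
  have hgc : g c = f c := by simp [hg]
  have hgd : DifferentiableOn ℂ g (ball c R) :=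
    hd.sub (by fun_prop)
  have hmaps : Set.MapsTo g (ball c R) (closedBall (g c) (4 * M)) := by
    intro z hz
    rw [mem_closedBall, dist_eq_norm, hgc]
    have h1 := hM z hz
    have h2 := hM c (mem_ball_self hR)
    have h3 : ‖fderiv ℂ f c (z - c)‖ ≤ 2 * M := by
      refine ((fderiv ℂ f c).le_opNorm _).trans ?_
      have hz' : ‖z - c‖ ≤ R := by rw [mem_ball, dist_eq_norm] at hz; exact hz.le
      calc _ ≤ 2 * M / R * R := mul_le_mul hf' hz' (norm_nonneg _) ((norm_nonneg _).trans hf')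
        _ = 2 * M := by field_simp
    calc ‖g z - f c‖ = ‖f z - f c - fderiv ℂ f c (z - c)‖ := by rw [hg]; congr 1; ring
      _ ≤ ‖f z‖ + ‖f c‖ + ‖fderiv ℂ f c (z - c)‖ :=
        (norm_sub_le _ _).trans (add_le_add_left (norm_sub_le _ _) _)
      _ ≤ 4 * M := by linarith
  have ho : (g · - g c) =o[𝓝 c] (fun z => ‖z - c‖ ^ 1) := by
    have := hfc.hasFDerivAt.isLittleO
    simp only [pow_one]
    refine this.norm_right.congr_left fun z => ?_
    simp [hg]
    ring
  have h := Complex.dist_le_mul_div_pow_of_mapsTo_ball_of_isLittleO hgd hmaps ho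
    (z := c + w) (by simpa [mem_ball] using hw)
  rw [dist_eq_norm, hgc, dist_eq_norm] at h
  simpa [hg, sub_right_comm] using h

/-- Directional derivatives of holomorphic functions of several variables are holomorphic. -/
lemma DifferentiableOn.differentiableOn_fderiv_apply {f : E → ℂ} {U : Set E} (hU : IsOpen U)
    (hf : DifferentiableOn ℂ f U) (v : E) : DifferentiableOn ℂ (fun z => fderiv ℂ f z v) U := by
  intro x hx
  refine DifferentiableAt.differentiableWithinAt ?_
  obtain ⟨r, hr, hrU, M, hM⟩ :
      ∃ r > 0, ball x (3 * r) ⊆ U ∧ ∃ M, ∀ z ∈ ball x (3 * r), ‖f z‖ ≤ M := by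
    have hc : ContinuousAt f x := (hf.differentiableAt (hU.mem_nhds hx)).continuousAt
    have h1 : ∀ᶠ z in 𝓝 x, z ∈ U ∧ ‖f z‖ < ‖f x‖ + 1 :=
      (hU.eventually_mem hx).and
        (hc.norm.eventually_lt continuousAt_const (lt_add_one _))
    obtain ⟨ε, hε, h2⟩ := Metric.eventually_nhds_iff_ball.1 h1
    refine ⟨ε / 3, by positivity, ?_, ‖f x‖ + 1, ?_⟩ <;> rw [mul_div_cancel₀ _ three_ne_zero]
    · exact fun z hz => (h2 z hz).1
    · exact fun z hz => (h2 z hz).2.le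
  have hM0 : 0 ≤ M := (norm_nonneg _).trans (hM x (mem_ball_self (by positivity)))
  -- difference quotients with increments short enough to stay inside the larger ball
  set t : ℕ → ℝ := fun n => r / ((n + 1) * (‖v‖ + 1)) with ht
  have ht0 : ∀ n, 0 < t n := fun n => by simp only [ht]; positivity
  have htv : ∀ n, ‖(t n : ℂ) • v‖ < r := by
    intro n
    rw [norm_smul, Complex.norm_real, Real.norm_eq_abs, abs_of_pos (ht0 n)]
    simp only [ht]
    rw [div_mul_eq_mul_div, div_lt_iff₀ (by positivity)]
    have hv := norm_nonneg v
    have hn : (0 : ℝ) ≤ n := n.cast_nonneg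
    nlinarith [mul_nonneg hn hv, mul_nonneg hr.le (mul_nonneg hn hv), mul_nonneg hr.le hn]
  have htt : Tendsto t atTop (𝓝 0) := by
    have : t = fun n : ℕ => (r / (‖v‖ + 1)) * (1 / ((n : ℝ) + 1)) := by
      ext n; simp only [ht]; field_simp
    rw [this]
    simpa using tendsto_one_div_add_atTop_nhds_zero_nat.const_mul (r / (‖v‖ + 1))
  set F : ℕ → E → ℂ := fun n z => (t n : ℂ)⁻¹ * (f (z + (t n : ℂ) • v) - f z) with hF
  have hsub : ∀ z ∈ ball x r, ball z (2 * r) ⊆ ball x (3 * r) := fun z hz =>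
    ball_subset_ball' (by rw [mem_ball] at hz; linarith)
  apply differentiableAt_of_tendstoUniformlyOn_ball (F := F) (l := atTop) hr
  · intro n
    refine DifferentiableOn.const_mul (DifferentiableOn.sub ?_ ?_) _
    · refine hf.comp (by fun_prop) fun z hz => hrU (hsub z hz ?_)
      rw [mem_ball, dist_eq_norm, add_sub_cancel_left]
      linarith [htv n]
    · exact hf.mono fun z hz => hrU (ball_subset_ball (by linarith) hz)
  · rw [Metric.tendstoUniformlyOn_iff]
    intro ε hε
    have hlim : Tendsto (fun n => 4 * M * (‖v‖ / (2 * r)) ^ 2 * t n) atTop (𝓝 0) := by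
      simpa using htt.const_mul (4 * M * (‖v‖ / (2 * r)) ^ 2)
    filter_upwards [hlim.eventually_lt_const hε] with n hn z hz
    have h1 := norm_sub_sub_fderiv_le (f := f) (c := z) (w := (t n : ℂ) • v) (R := 2 * r) (M := M)
      (by positivity) (hf.mono ((hsub z hz).trans hrU)) (fun y hy => hM y (hsub z hz hy))
      (by linarith [htv n])
    refine lt_of_le_of_lt ?_ hn
    have htc : (t n : ℂ) ≠ 0 := by exact_mod_cast (ht0 n).ne'
    have e1 : fderiv ℂ f z v - F n z =
        -((t n : ℂ)⁻¹ * (f (z + (t n : ℂ) • v) - f z - fderiv ℂ f z ((t n : ℂ) • v))) := by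
      simp only [hF, map_smul, smul_eq_mul]
      field_simp
      ring
    rw [dist_eq_norm, e1, norm_neg, norm_mul, norm_inv, Complex.norm_real, Real.norm_eq_abs,
      abs_of_pos (ht0 n)]
    rw [norm_smul, Complex.norm_real, Real.norm_eq_abs, abs_of_pos (ht0 n)] at h1
    calc _ ≤ (t n)⁻¹ * (4 * M * (t n * ‖v‖ / (2 * r)) ^ 2) :=
          mul_le_mul_of_nonneg_left h1 (inv_nonneg.2 (ht0 n).le)
      _ = _ := by have := (ht0 n).ne'; field_simp

end SeveralVariables

/-! ### Homogeneous Taylor polynomials -/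

/-- The monomial `z₁₁ᵖ z₁₂^q z₂₁ʳ z₂₂ˢ` as a function. -/
noncomputable def entryMonomial (p q r s : ℕ) (Z : MatSpace) : ℂ :=
  Z 0 0 ^ p * Z 0 1 ^ q * Z 1 0 ^ r * Z 1 1 ^ s

/-- The space of homogeneous polynomial functions of degree `k` of the matrix entries. -/
noncomputable def homPoly (k : ℕ) : Submodule ℂ (MatSpace → ℂ) :=
  Submodule.span ℂ {f | ∃ p q r s : ℕ, p + q + r + s = k ∧ f = entryMonomial p q r s}

lemma entryMonomial_mem_homPoly {k p q r s : ℕ} (h : p + q + r + s = k) :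
    entryMonomial p q r s ∈ homPoly k :=
  Submodule.subset_span ⟨p, q, r, s, h, rfl⟩

lemma entry_mul_mem_homPoly {k : ℕ} {f : MatSpace → ℂ} (hf : f ∈ homPoly k) (i j : Fin 2) :
    (fun Z => Z i j * f Z) ∈ homPoly (k + 1) := by
  induction hf using Submodule.span_induction with
  | mem f hf =>
    obtain ⟨p, q, r, s, h, rfl⟩ := hf
    obtain ⟨p', q', r', s', h', e⟩ : ∃ p' q' r' s' : ℕ, p' + q' + r' + s' = k + 1 ∧
        (fun Z => Z i j * entryMonomial p q r s Z) = entryMonomial p' q' r' s' := by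
      fin_cases i <;> fin_cases j
      · exact ⟨p + 1, q, r, s, by omega, by ext Z; simp [entryMonomial]; ring⟩
      · exact ⟨p, q + 1, r, s, by omega, by ext Z; simp [entryMonomial]; ring⟩
      · exact ⟨p, q, r + 1, s, by omega, by ext Z; simp [entryMonomial]; ring⟩
      · exact ⟨p, q, r, s + 1, by omega, by ext Z; simp [entryMonomial]; ring⟩
    rw [e]
    exact entryMonomial_mem_homPoly h'
  | zero =>
    simp only [Pi.zero_apply, mul_zero]
    exact (homPoly (k + 1)).zero_mem
  | add f g _ _ hf hg =>
    convert! (homPoly (k + 1)).add_mem hf hg using 1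
    ext Z
    simp [mul_add]
  | smul c f _ hf =>
    convert! (homPoly (k + 1)).smul_mem c hf using 1
    ext Z
    simp [mul_left_comm]

lemma matSpace_eq_sum_single (Z : MatSpace) :
    Z = ∑ i, ∑ j, Z i j • (Pi.single i (Pi.single j (1 : ℂ)) : MatSpace) := by
  ext i j
  fin_cases i <;> fin_cases j <;> simp [Fin.sum_univ_two]

/-- The derivatives at `0` of `ζ ↦ f(ζ Z)` are homogeneous polynomials in `Z`: the chain rule
expresses the first derivative through the partial derivatives of `f`, to which the claim applies
with the order lowered by one. -/
lemma exists_homPoly_iteratedDeriv (k : ℕ) {f : MatSpace → ℂ} {U : Set MatSpace} (hU : IsOpen U)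
    (h0 : (0 : MatSpace) ∈ U) (hf : DifferentiableOn ℂ f U) :
    ∃ P ∈ homPoly k, ∀ Z : MatSpace, iteratedDeriv k (fun ζ : ℂ => f (ζ • Z)) 0 = P Z := by
  induction k generalizing f with
  | zero =>
    refine ⟨f 0 • entryMonomial 0 0 0 0, Submodule.smul_mem _ _ (entryMonomial_mem_homPoly rfl),
      fun Z => ?_⟩
    simp [entryMonomial]
  | succ k ih =>
    set g : Fin 2 → Fin 2 → MatSpace → ℂ := fun i j z =>
      fderiv ℂ f z (Pi.single i (Pi.single j (1 : ℂ))) with hg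
    have hgd : ∀ i j, DifferentiableOn ℂ (g i j) U := fun i j =>
      hf.differentiableOn_fderiv_apply hU _
    choose P hP hPe using fun i j => ih (hgd i j)
    refine ⟨∑ i, ∑ j, fun Z => Z i j * P i j Z, Submodule.sum_mem _ fun i _ =>
      Submodule.sum_mem _ fun j _ => entry_mul_mem_homPoly (hP i j) i j, fun Z => ?_⟩
    set V : Set ℂ := (fun ζ : ℂ => ζ • Z) ⁻¹' U with hV
    have hVo : IsOpen V := hU.preimage (by fun_prop)
    have hV0 : (0 : ℂ) ∈ V := by simpa [hV] using h0
    have hderiv : deriv (fun ζ : ℂ => f (ζ • Z)) =ᶠ[nhds 0]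
        fun ζ => ∑ i, ∑ j, Z i j * g i j (ζ • Z) := by
      filter_upwards [hVo.mem_nhds hV0] with ζ hζ
      have h1 : HasFDerivAt f (fderiv ℂ f (ζ • Z)) (ζ • Z) :=
        (hf.differentiableAt (hU.mem_nhds hζ)).hasFDerivAt
      have h2 : HasDerivAt (fun ζ : ℂ => ζ • Z) Z ζ := by
        simpa using (hasDerivAt_id ζ).smul_const Z
      have h3 := h1.comp_hasDerivAt ζ h2
      have h4 : deriv (fun ζ : ℂ => f (ζ • Z)) ζ = fderiv ℂ f (ζ • Z) Z := h3.deriv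
      rw [h4]
      conv_lhs => rw [matSpace_eq_sum_single Z]
      simp only [map_sum, map_smul, smul_eq_mul, hg]
      congr!
      all_goals exact (matSpace_eq_sum_single Z).symm
    have hcd : ∀ i j, ContDiffAt ℂ k (fun ζ : ℂ => g i j (ζ • Z)) 0 := by
      intro i j
      have h1 : DifferentiableOn ℂ (fun ζ : ℂ => g i j (ζ • Z)) V :=
        (hgd i j).comp (by fun_prop) fun ζ hζ => hζ
      exact (h1.analyticAt (hVo.mem_nhds hV0)).contDiffAt
    rw [iteratedDeriv_succ', hderiv.iteratedDeriv_eq]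
    rw [iteratedDeriv_fun_sum fun i _ => ContDiffAt.sum fun j _ =>
      contDiffAt_const.mul (hcd i j)]
    rw [Finset.sum_apply]
    refine Finset.sum_congr rfl fun i _ => ?_
    rw [iteratedDeriv_fun_sum fun j _ => contDiffAt_const.mul (hcd i j), Finset.sum_apply]
    refine Finset.sum_congr rfl fun j _ => ?_
    rw [iteratedDeriv_const_mul_field, hPe]

/-! ### Averages over circles -/

lemma measurePreserving_smul_volume {c : ℂ} (hc : ‖c‖ = 1) :
    MeasurePreserving (fun Z : MatSpace => c • Z) volume volume := by
  refine measurePreserving_volume_of_sqNorm (c • LinearMap.id) fun Z => ?_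
  simp [sqNorm, hc]

lemma measurePreserving_smul_nuMeasure {lam : ℕ} (h : 4 ≤ lam) {c : ℂ} (hc : ‖c‖ = 1) :
    MeasurePreserving (fun Z : MatSpace => c • Z) (nuMeasure lam) (nuMeasure lam) := by
  refine measurePreserving_nuMeasure h (c • LinearMap.id) (fun Z => ?_) fun Z => ?_
  · simp [sqNorm, hc]
  · have : c * Z 0 0 * (c * Z 1 1) - c * Z 0 1 * (c * Z 1 0) =
        c ^ 2 * (Z 0 0 * Z 1 1 - Z 0 1 * Z 1 0) := by ring
    simp [detGap, sqNorm, hc, this]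

/-- For a measure invariant under the circle action, the integral of a function is the integral of
its averages over circles. -/
lemma integral_eq_integral_circleAverage {μ : Measure MatSpace} [SFinite μ]
    (hμ : ∀ c : ℂ, ‖c‖ = 1 → MeasurePreserving (fun Z : MatSpace => c • Z) μ μ)
    {F : MatSpace → ℂ} (hF : Measurable F) (hFi : Integrable F μ) :
    ∫ Z, F Z ∂μ = ∫ Z, Real.circleAverage (fun ζ => F (ζ • Z)) 0 1 ∂μ := by
  have hnorm : ∀ θ : ℝ, ‖circleMap 0 1 θ‖ = 1 := fun θ => by simp
  have hcomp : ∀ θ : ℝ, ∀ G : MatSpace → ℂ, Measurable G →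
      ∫ Z, G (circleMap 0 1 θ • Z) ∂μ = ∫ Z, G Z ∂μ := by
    intro θ G hG
    have hp := hμ _ (hnorm θ)
    have := integral_map hp.measurable.aemeasurable (f := G) (μ := μ)
      hG.aestronglyMeasurable
    rw [← this, hp.map_eq]
  have hcomp' : ∀ θ : ℝ, ∫ Z, ‖F (circleMap 0 1 θ • Z)‖ ∂μ = ∫ Z, ‖F Z‖ ∂μ := by
    intro θ
    have hp := hμ _ (hnorm θ)
    have := integral_map hp.measurable.aemeasurable (f := fun Z => ‖F Z‖) (μ := μ)
      hF.norm.aestronglyMeasurable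
    rw [← this, hp.map_eq]
  unfold Real.circleAverage
  rw [integral_smul]
  have hint : Integrable (Function.uncurry fun (Z : MatSpace) (θ : ℝ) => F (circleMap 0 1 θ • Z))
      (μ.prod (volume.restrict (Set.Ioc 0 (2 * Real.pi)))) := by
    rw [integrable_prod_iff']
    · refine ⟨Filter.Eventually.of_forall fun θ => ?_, ?_⟩
      · exact (hμ _ (hnorm θ)).integrable_comp_of_integrable hFi
      · simp only [Function.uncurry, hcomp']
        exact integrable_const _
    · refine (hF.comp ?_).aestronglyMeasurable
      exact ((continuous_circleMap 0 1).measurable.comp measurable_snd).smul measurable_fst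
  have h1 : ∫ Z, (∫ θ in (0 : ℝ)..2 * Real.pi, F (circleMap 0 1 θ • Z)) ∂μ =
      ∫ θ in (0 : ℝ)..2 * Real.pi, (∫ Z, F Z ∂μ) := by
    simp only [intervalIntegral.integral_of_le Real.two_pi_pos.le]
    rw [integral_integral_swap hint]
    simp only [hcomp _ F hF]
  rw [h1, intervalIntegral.integral_const, smul_smul, sub_zero,
    inv_mul_cancel₀ Real.two_pi_pos.ne', one_smul]

/-- Taylor coefficients as Fourier coefficients. -/
lemma circleAverage_conj_pow_mul {g : ℂ → ℂ} {R : ℝ} (hR : 1 < R)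
    (hg : DifferentiableOn ℂ g (Metric.ball 0 R)) (d : ℕ) :
    Real.circleAverage (fun ζ => conj ζ ^ d * g ζ) 0 1 =
      (d.factorial : ℂ)⁻¹ * iteratedDeriv d g 0 := by
  have hdc : DiffContOnCl ℂ g (Metric.ball 0 1) :=
    (hg.mono (Metric.closedBall_subset_ball hR)).diffContOnCl_ball Set.Subset.rfl
  have h1 := hdc.circleIntegral_one_div_sub_center_pow_smul one_pos d
  have h2 : Real.circleAverage (fun ζ => conj ζ ^ d * g ζ) 0 1 =
      Real.circleAverage (fun ζ => (ζ ^ d)⁻¹ * g ζ) 0 1 := by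
    apply Real.circleAverage_congr_sphere
    intro ζ hζ
    have hζ1 : ‖ζ‖ = 1 := by simpa using hζ
    have : conj ζ = ζ⁻¹ := by
      rw [Complex.inv_def, Complex.normSq_eq_norm_sq, hζ1]; simp
    simp [this]
  rw [h2, Real.circleAverage_eq_circleIntegral one_ne_zero]
  have h3 : (∮ z in C(0, 1), (z - 0)⁻¹ • ((z ^ d)⁻¹ * g z)) =
      ∮ z in C(0, 1), (1 / (z - 0) ^ (d + 1)) • g z := by
    congr 1
    ext z
    simp only [sub_zero, smul_eq_mul, one_div, pow_succ, mul_inv]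
    ring
  rw [h3, h1, smul_eq_mul, smul_eq_mul]
  have hf : (d.factorial : ℂ) ≠ 0 := by exact_mod_cast d.factorial_ne_zero
  have hpi : (Real.pi : ℂ) ≠ 0 := by exact_mod_cast Real.pi_ne_zero
  field_simp [Complex.I_ne_zero]

/-- The disc `{ζ : ζ Z ∈ D₄}` through a point `Z` of the domain has radius greater than `1`. -/
lemma exists_one_lt_smul_mem_cartanDomain {Z : MatSpace} (hZ : Z ∈ cartanDomain) :
    ∃ R : ℝ, 1 < R ∧ ∀ ζ ∈ Metric.ball (0 : ℂ) R, ζ • Z ∈ cartanDomain := by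
  have hc : ContinuousAt (fun t : ℝ => (t : ℂ) • Z) 1 := by fun_prop
  have h1 : ∀ᶠ t : ℝ in nhds 1, (t : ℂ) • Z ∈ cartanDomain := by
    apply hc.eventually_mem
    simpa using isOpen_cartanDomain.mem_nhds hZ
  obtain ⟨ε, hε, h2⟩ := Metric.eventually_nhds_iff_ball.1 h1
  have h3 : ((1 + ε / 2 : ℝ) : ℂ) • Z ∈ cartanDomain := by
    apply h2
    rw [Metric.mem_ball, Real.dist_eq, add_sub_cancel_left, abs_of_pos (by positivity)]
    linarith
  refine ⟨1 + ε / 2, by linarith, fun ζ hζ => ?_⟩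
  have hpos : (0 : ℝ) < 1 + ε / 2 := by positivity
  have hne : ((1 + ε / 2 : ℝ) : ℂ) ≠ 0 := by exact_mod_cast hpos.ne'
  have e : ζ • Z = (ζ / ((1 + ε / 2 : ℝ) : ℂ)) • (((1 + ε / 2 : ℝ) : ℂ) • Z) := by
    rw [smul_smul, div_mul_cancel₀ _ hne]
  rw [e]
  apply smul_mem_cartanDomain h3
  rw [norm_div, Complex.norm_real, Real.norm_eq_abs, abs_of_pos hpos, div_le_one hpos]
  rw [mem_ball_zero_iff] at hζ
  exact hζ.le

/-! ### Completeness of the space of square integrable holomorphic functions -/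

lemma measurable_indicator_of_differentiableOn {g : MatSpace → ℂ} {U : Set MatSpace}
    (hU : IsOpen U) (hg : DifferentiableOn ℂ g U) : Measurable (U.indicator g) := by
  classical
  rw [← Set.piecewise_eq_indicator]
  exact hg.continuousOn.measurable_piecewise continuousOn_const hU.measurableSet

/-- The mean value property over a ball. -/
lemma integral_ball_eq_of_differentiableOn {g : MatSpace → ℂ} {y : MatSpace} {r R : ℝ}
    (hrR : r < R) (hg : DifferentiableOn ℂ g (Metric.ball y R)) :
    ∫ W in Metric.ball (0 : MatSpace) r, g (y + W) =
      (volume (Metric.ball (0 : MatSpace) r)).toReal * g y := by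
  set B := Metric.ball (0 : MatSpace) r with hB
  have hBm : MeasurableSet B := Metric.isOpen_ball.measurableSet
  have hgd : DifferentiableOn ℂ (fun W => g (y + W)) (Metric.ball 0 R) := by
    refine hg.comp (by fun_prop) fun W hW => ?_
    simpa [Metric.mem_ball, dist_eq_norm] using hW
  have hcl : ContinuousOn (fun W => g (y + W)) (Metric.closedBall (0 : MatSpace) r) :=
    hgd.continuousOn.mono (Metric.closedBall_subset_ball hrR)
  set F : MatSpace → ℂ := B.indicator fun W => g (y + W) with hF
  have hFm : Measurable F := measurable_indicator_of_differentiableOn Metric.isOpen_ball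
    (hgd.mono (Metric.ball_subset_ball hrR.le))
  have hFi : Integrable F := by
    rw [hF, integrable_indicator_iff hBm]
    exact (hcl.integrableOn_compact (isCompact_closedBall _ _)).mono_set
      Metric.ball_subset_closedBall
  rw [← integral_indicator hBm]
  change ∫ W, F W = _
  rw [integral_eq_integral_circleAverage (fun c hc => measurePreserving_smul_volume hc) hFm hFi]
  have h1 : ∀ W, Real.circleAverage (fun ζ => F (ζ • W)) 0 1 = B.indicator (fun _ => g y) W := by
    intro W
    have h2 : Real.circleAverage (fun ζ => F (ζ • W)) 0 1 =
        Real.circleAverage (fun ζ => B.indicator (fun _ => g (y + ζ • W)) W) 0 1 := by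
      apply Real.circleAverage_congr_sphere
      intro ζ hζ
      have hζ1 : ‖ζ‖ = 1 := by simpa using hζ
      have hiff : ζ • W ∈ B ↔ W ∈ B := by
        simp [hB, norm_smul, hζ1]
      by_cases hW : W ∈ B
      · simp only [hF, Set.indicator_of_mem hW, Set.indicator_of_mem (hiff.2 hW)]
      · simp only [hF, Set.indicator_of_notMem hW, Set.indicator_of_notMem (mt hiff.1 hW)]
    rw [h2]
    by_cases hW : W ∈ B
    · simp only [Set.indicator_of_mem hW]
      have hd : DifferentiableOn ℂ (fun ζ : ℂ => g (y + ζ • W)) (Metric.closedBall 0 |1|) := by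
        refine hgd.comp (by fun_prop : DifferentiableOn ℂ (fun ζ : ℂ => ζ • W) _) fun ζ hζ => ?_
        simp only [hB, abs_one, Metric.mem_closedBall, dist_zero_right, mem_ball_zero_iff] at hζ hW ⊢
        rw [norm_smul]
        nlinarith [norm_nonneg W]
      have := (hd.diffContOnCl_ball Set.Subset.rfl).circleAverage
      simpa using this
    · simp only [Set.indicator_of_notMem hW]
      simp [Real.circleAverage]
  simp only [h1]
  rw [integral_indicator hBm, setIntegral_const, Complex.real_smul]
  rfl

/-- Point evaluations of holomorphic functions are bounded in `L²(ν_λ)`, locally uniformly. -/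
lemma exists_norm_le_mul_norm {lam : ℕ} (h : 4 ≤ lam) {x : MatSpace} (hx : x ∈ cartanDomain) :
    ∃ r > 0, ∃ C : ℝ, Metric.ball x r ⊆ cartanDomain ∧ ∀ (f : Lp ℂ 2 (nuMeasure lam))
      (g : MatSpace → ℂ), DifferentiableOn ℂ g cartanDomain → f =ᵐ[nuMeasure lam] g →
      ∀ y ∈ Metric.ball x r, ‖g y‖ ≤ C * ‖f‖ := by
  have := isFiniteMeasure_nuMeasure h
  obtain ⟨ε, hε, hεD⟩ := Metric.isOpen_iff.1 isOpen_cartanDomain x hx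
  set r := ε / 4 with hr
  have hr0 : 0 < r := by positivity
  have hKD : Metric.closedBall x (3 * r) ⊆ cartanDomain :=
    (Metric.closedBall_subset_ball (by rw [hr]; linarith)).trans hεD
  obtain ⟨z0, hz0, hmin⟩ := (isCompact_closedBall x (3 * r)).exists_isMinOn
    ⟨x, Metric.mem_closedBall_self (by positivity)⟩ (continuous_nuDensity lam).continuousOn
  set δ := nuDensity lam z0 with hδ
  have hδ0 : 0 < δ := nuDensity_pos h (hKD hz0)
  set v := volume (Metric.ball (0 : MatSpace) r) with hv
  have hv0 : v ≠ 0 := (Metric.measure_ball_pos volume _ hr0).ne'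
  have hvt : v ≠ ⊤ := Metric.isBounded_ball.measure_lt_top.ne
  set A := nuMeasure lam Set.univ ^ (1 / (1 : ENNReal).toReal - 1 / (2 : ENNReal).toReal) with hA
  have hAt : A ≠ ⊤ := by
    apply ENNReal.rpow_ne_top_of_nonneg
    · norm_num
    · exact measure_ne_top _ _
  refine ⟨r, hr0, A.toReal / (v.toReal * δ), ?_, ?_⟩
  · exact (Metric.ball_subset_closedBall.trans (Metric.closedBall_subset_closedBall
      (by linarith))).trans hKD
  intro f g hg hfg y hy
  have hyr : Metric.ball y (2 * r) ⊆ Metric.closedBall x (3 * r) := by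
    intro w hw
    rw [Metric.mem_ball] at hw hy
    rw [Metric.mem_closedBall]
    linarith [dist_triangle w y x]
  set G := cartanDomain.indicator g with hG
  have hGm : Measurable G := measurable_indicator_of_differentiableOn isOpen_cartanDomain hg
  have hmean := integral_ball_eq_of_differentiableOn (r := r) (R := 2 * r) (by linarith)
    (hg.mono (hyr.trans hKD))
  -- the mean value property bounds `vol(B) |g(y)|` by the `L¹` norm near `x`
  have h1 : v * ‖g y‖ₑ ≤ ∫⁻ W in Metric.closedBall x (3 * r), ‖G W‖ₑ := by
    have h2 : v * ‖g y‖ₑ = ‖((v.toReal : ℝ) : ℂ) * g y‖ₑ := by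
      rw [enorm_mul]
      congr 1
      rw [← ofReal_norm, Complex.norm_real, Real.norm_eq_abs, abs_of_nonneg ENNReal.toReal_nonneg,
        ENNReal.ofReal_toReal hvt]
    rw [h2, ← hmean]
    refine (enorm_integral_le_lintegral_enorm _).trans ?_
    rw [← lintegral_indicator Metric.isOpen_ball.measurableSet,
      ← lintegral_indicator Metric.isClosed_closedBall.measurableSet,
      ← lintegral_add_left_eq_self (μ := volume)
        ((Metric.closedBall x (3 * r)).indicator fun W => ‖G W‖ₑ) y]
    refine lintegral_mono fun W => ?_
    by_cases hW : W ∈ Metric.ball (0 : MatSpace) r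
    · have hyW : y + W ∈ Metric.closedBall x (3 * r) := by
        apply hyr
        rw [mem_ball_zero_iff] at hW
        rw [Metric.mem_ball, dist_eq_norm, add_sub_cancel_left]
        linarith
      rw [Set.indicator_of_mem hW, Set.indicator_of_mem hyW, hG,
        Set.indicator_of_mem (hKD hyW)]
    · rw [Set.indicator_of_notMem hW]
      exact zero_le
  have h3 : ENNReal.ofReal δ * ∫⁻ W in Metric.closedBall x (3 * r), ‖G W‖ₑ ≤
      ∫⁻ Z, ‖G Z‖ₑ ∂(nuMeasure lam) := by
    rw [lintegral_nuMeasure h hGm.enorm, ← lintegral_const_mul _ hGm.enorm]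
    refine (setLIntegral_mono' Metric.isClosed_closedBall.measurableSet fun Z hZ => ?_).trans
      (lintegral_mono_set hKD)
    gcongr
    exact hmin hZ
  have h4 : ∫⁻ Z, ‖G Z‖ₑ ∂(nuMeasure lam) ≤ eLpNorm f 2 (nuMeasure lam) * A := by
    have hfG : f =ᵐ[nuMeasure lam] G := by
      filter_upwards [hfg, ae_mem_cartanDomain lam] with Z h1 h2
      rw [h1, hG, Set.indicator_of_mem h2]
    rw [← eLpNorm_one_eq_lintegral_enorm, ← eLpNorm_congr_ae hfG]
    exact eLpNorm_le_eLpNorm_mul_rpow_measure_univ (by norm_num) (Lp.aestronglyMeasurable f)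
  have h5 : ENNReal.ofReal δ * (v * ‖g y‖ₑ) ≤ eLpNorm f 2 (nuMeasure lam) * A :=
    (mul_le_mul_right h1 _).trans (h3.trans h4)
  have h6 := ENNReal.toReal_mono (ENNReal.mul_ne_top (Lp.eLpNorm_ne_top f) hAt) h5
  rw [ENNReal.toReal_mul, ENNReal.toReal_mul, ENNReal.toReal_mul, ENNReal.toReal_ofReal hδ0.le,
    ← Lp.norm_def, toReal_enorm] at h6
  have hvr : 0 < v.toReal := ENNReal.toReal_pos hv0 hvt
  rw [div_mul_eq_mul_div, le_div_iff₀ (by positivity)]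
  linarith

lemma isClosed_holoL2 {lam : ℕ} (h : 4 ≤ lam) :
    IsClosed (holoL2 lam : Set (Lp ℂ 2 (nuMeasure lam))) := by
  apply IsSeqClosed.isClosed
  intro f F hf hF
  choose g hg hfg using hf
  choose! r hr C hrD hC using fun x (hx : x ∈ cartanDomain) => exists_norm_le_mul_norm h hx
  have hcauchy : ∀ x ∈ cartanDomain, UniformCauchySeqOn g Filter.atTop (Metric.ball x (r x)) := by
    intro x hx
    rw [Metric.uniformCauchySeqOn_iff]
    intro ε hε
    obtain ⟨N, hN⟩ := Metric.cauchySeq_iff.1 hF.cauchySeq (ε / (|C x| + 1)) (by positivity)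
    refine ⟨N, fun m hm n hn y hy => ?_⟩
    have h1 := hC x hx (f m - f n) (g m - g n) ((hg m).sub (hg n))
      ((Lp.coeFn_sub _ _).trans ((hfg m).sub (hfg n))) y hy
    have h2 := hN m hm n hn
    rw [dist_eq_norm] at h2 ⊢
    rw [lt_div_iff₀ (by positivity)] at h2
    refine lt_of_le_of_lt h1 ?_
    have h3 := le_abs_self (C x)
    have h4 := norm_nonneg (f m - f n)
    nlinarith
  have hlim : ∀ x ∈ cartanDomain, ∃ L, Filter.Tendsto (fun n => g n x) Filter.atTop (nhds L) :=
    fun x hx => cauchy_map_iff_exists_tendsto.1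
      ((hcauchy x hx).cauchy_map (Metric.mem_ball_self (hr x hx)))
  choose! G hG using hlim
  refine ⟨G, fun x hx => ?_, ?_⟩
  · refine (differentiableAt_of_tendstoUniformlyOn_ball (hr x hx)
      (fun n => (hg n).mono (hrD x hx)) ((hcauchy x hx).tendstoUniformlyOn_of_tendsto
      fun y hy => hG y (hrD x hx hy))).differentiableWithinAt
  · obtain ⟨ns, hns, hae⟩ := (tendstoInMeasure_of_tendsto_Lp hF).exists_seq_tendsto_ae
    have hall : ∀ᵐ Z ∂(nuMeasure lam), ∀ n, f n Z = g n Z := ae_all_iff.2 hfg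
    filter_upwards [hae, hall, ae_mem_cartanDomain lam] with Z h1 h2 h3
    refine tendsto_nhds_unique h1 ?_
    simp only [h2]
    exact (hG Z h3).comp hns.tendsto_atTop

/-! ### Polynomials are combinations of the basis functions -/

/-- The span of the functions `det(Z)ᵐ D_{ab}(Z)` of degree `k`. -/
noncomputable def wignerSpan (k : ℕ) : Submodule ℂ (MatSpace → ℂ) :=
  Submodule.span ℂ {f | ∃ n m a b : ℕ, n + 2 * m = k ∧ a ≤ n ∧ b ≤ n ∧ f = detWigner n m a b}

lemma det_mul_mem_wignerSpan {k : ℕ} {f : MatSpace → ℂ} (hf : f ∈ wignerSpan k) :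
    (fun Z => (Matrix.of Z).det * f Z) ∈ wignerSpan (k + 2) := by
  induction hf using Submodule.span_induction with
  | mem f hf =>
    obtain ⟨n, m, a, b, h, ha, hb, rfl⟩ := hf
    refine Submodule.subset_span ⟨n, m + 1, a, b, by omega, ha, hb, ?_⟩
    ext Z
    simp only [detWigner]
    ring
  | zero =>
    simp only [Pi.zero_apply, mul_zero]
    exact (wignerSpan (k + 2)).zero_mem
  | add f g _ _ hf hg =>
    convert! (wignerSpan (k + 2)).add_mem hf hg using 1
    ext Z
    simp [mul_add]
  | smul c f _ hf =>
    convert! (wignerSpan (k + 2)).smul_mem c hf using 1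
    ext Z
    simp [mul_left_comm]

/-- Monomials of the same weight are congruent modulo `det(Z)`. -/
lemma entryMonomial_sub_mem_wignerSpan {k : ℕ} (ih : ∀ k' < k, homPoly k' ≤ wignerSpan k')
    (j p q r s : ℕ) (h : p + q + r + s + 2 * j = k) :
    entryMonomial (p + j) q r (s + j) - entryMonomial p (q + j) (r + j) s ∈ wignerSpan k := by
  induction j generalizing q r with
  | zero => simp
  | succ j hj =>
    have h1 := hj (q + 1) (r + 1) (by omega)
    have h2 : (fun Z => (Matrix.of Z).det * entryMonomial (p + j) q r (s + j) Z) ∈ wignerSpan k := by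
      obtain ⟨k', rfl⟩ : ∃ k', k = k' + 2 := ⟨k - 2, by omega⟩
      exact det_mul_mem_wignerSpan
        (ih k' (by omega) (entryMonomial_mem_homPoly (by omega)))
    convert! (wignerSpan k).add_mem h1 h2 using 1
    ext Z
    simp only [Pi.sub_apply, Pi.add_apply, entryMonomial, Matrix.det_fin_two, Matrix.of_apply]
    ring

/-- Modulo `det(Z)` the polynomial `D_{ab}` is a positive multiple of each monomial of its weight. -/
lemma homPoly_le_wignerSpan (k : ℕ) : homPoly k ≤ wignerSpan k := by
  induction k using Nat.strong_induction_on with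
  | _ n ih =>
    refine Submodule.span_le.2 ?_
    rintro _ ⟨p, q, r, s, hn, rfl⟩
    set a := p + q with ha
    set b := p + r with hb
    set M : ℕ → MatSpace → ℂ := fun k => entryMonomial k (a - k) (b - k) (k + n - (a + b)) with hM
    have hMp : entryMonomial p q r s = M p := by
      simp only [hM]
      congr 1 <;> omega
    set c : ℕ → ℕ := fun k => b.choose k * (n - b).choose (k + n - (a + b)) with hc
    set I := Finset.Icc (a + b - n) (min a b) with hI
    have hpI : p ∈ I := by
      simp only [hI, Finset.mem_Icc, le_min_iff]
      omega
    have hle : ∀ k ∈ I, ∀ k' ∈ I, k ≤ k' → M k' - M k ∈ wignerSpan n := by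
      intro k hk k' hk' hkk
      simp only [hI, Finset.mem_Icc, le_min_iff] at hk hk'
      have := entryMonomial_sub_mem_wignerSpan ih (k' - k) k (a - k') (b - k') (k + n - (a + b))
        (by omega)
      convert! this using 2
      · simp only [hM]; congr 1 <;> omega
      · simp only [hM]; congr 1 <;> omega
    have hcong : ∀ k ∈ I, M k - M p ∈ wignerSpan n := by
      intro k hk
      rcases le_total p k with h | h
      · exact hle p hpI k hk h
      · rw [← neg_sub]
        exact (wignerSpan n).neg_mem (hle k hk p hpI h)
    have hsum : wignerSum n a b = ∑ k ∈ I, (c k : ℂ) • M k := by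
      ext Z
      rw [Finset.sum_apply]
      refine Finset.sum_congr rfl fun k _ => ?_
      simp only [hc, hM, entryMonomial, Pi.smul_apply, smul_eq_mul]
      push_cast
      ring
    have hW : wignerSum n a b ∈ wignerSpan n := by
      have h1 : detWigner n 0 a b ∈ wignerSpan n :=
        Submodule.subset_span ⟨n, 0, a, b, by omega, by omega, by omega, rfl⟩
      set t : ℂ := (√(((a.factorial * (n - a).factorial : ℕ) : ℝ) /
        ((b.factorial * (n - b).factorial : ℕ) : ℝ)) : ℂ) with ht
      have ht0 : t ≠ 0 := by
        have : (0 : ℝ) < √(((a.factorial * (n - a).factorial : ℕ) : ℝ) /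
            ((b.factorial * (n - b).factorial : ℕ) : ℝ)) := by positivity
        rw [ht]
        exact_mod_cast this.ne'
      have h2 : wignerSum n a b = t⁻¹ • detWigner n 0 a b := by
        ext Z
        simp only [detWigner, pow_zero, one_mul, Pi.smul_apply, smul_eq_mul]
        change _ = t⁻¹ * (t * wignerSum n a b Z)
        rw [inv_mul_cancel_left₀ ht0]
      rw [h2]
      exact (wignerSpan n).smul_mem _ h1
    set C : ℕ := ∑ k ∈ I, c k with hC
    have hCpos : 0 < C := by
      refine Finset.sum_pos' (fun _ _ => Nat.zero_le _) ⟨p, hpI, ?_⟩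
      exact Nat.mul_pos (Nat.choose_pos (by omega)) (Nat.choose_pos (by omega))
    have hmem : (C : ℂ) • M p ∈ wignerSpan n := by
      have h1 : (C : ℂ) • M p = wignerSum n a b - ∑ k ∈ I, (c k : ℂ) • (M k - M p) := by
        rw [hsum, ← Finset.sum_sub_distrib]
        simp only [smul_sub, sub_sub_cancel]
        rw [← Finset.sum_smul, hC]
        push_cast
        rfl
      rw [h1]
      exact (wignerSpan n).sub_mem hW
        ((wignerSpan n).sum_mem fun k hk => (wignerSpan n).smul_mem _ (hcong k hk))
    rw [SetLike.mem_coe, hMp]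
    have hC0 : (C : ℂ) ≠ 0 := by exact_mod_cast hCpos.ne'
    have := (wignerSpan n).smul_mem (C : ℂ)⁻¹ hmem
    rwa [smul_smul, inv_mul_cancel₀ hC0, one_smul] at this

lemma continuous_of_mem_homPoly {k : ℕ} {P : MatSpace → ℂ} (hP : P ∈ homPoly k) :
    Continuous P := by
  induction hP using Submodule.span_induction with
  | mem f hf =>
    obtain ⟨p, q, r, s, h, rfl⟩ := hf
    unfold entryMonomial
    fun_prop
  | zero => exact continuous_zero
  | add f g _ _ hf hg => exact hf.add hg
  | smul c f _ hf => exact hf.const_smul c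

lemma smul_of_mem_homPoly {k : ℕ} {P : MatSpace → ℂ} (hP : P ∈ homPoly k) (ζ : ℂ)
    (Z : MatSpace) : P (ζ • Z) = ζ ^ k * P Z := by
  induction hP using Submodule.span_induction with
  | mem f hf =>
    obtain ⟨p, q, r, s, rfl, rfl⟩ := hf
    simp only [entryMonomial, Pi.smul_apply, smul_eq_mul, mul_pow, pow_add]
    ring
  | zero => simp
  | add f g _ _ hf hg => simp [hf, hg, mul_add]
  | smul c f _ hf => simp [hf, mul_left_comm]

lemma exists_mvPolynomial_basisFun (lam : ℕ) (i : BasisIndex) :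
    ∃ p : MvPolynomial (Fin 2 × Fin 2) ℂ, p.IsHomogeneous (i.1.1 + 2 * i.1.2) ∧
      ∀ Z : MatSpace, basisFun lam i Z = MvPolynomial.eval (fun ij => Z ij.1 ij.2) p := by
  obtain ⟨⟨n, m⟩, a, b⟩ := i
  set x : Fin 2 → Fin 2 → MvPolynomial (Fin 2 × Fin 2) ℂ := fun i j => MvPolynomial.X (i, j)
  have hx : ∀ i j, (x i j).IsHomogeneous 1 := fun i j => MvPolynomial.isHomogeneous_X _ _
  refine ⟨MvPolynomial.C (√(radialConst lam n m) : ℂ) *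
    ((x 0 0 * x 1 1 - x 0 1 * x 1 0) ^ m *
      (MvPolynomial.C (√((((a : ℕ).factorial * (n - a).factorial : ℕ) : ℝ) /
        (((b : ℕ).factorial * (n - b).factorial : ℕ) : ℝ)) : ℂ) *
      ∑ k ∈ Finset.Icc ((a : ℕ) + b - n) (min a b),
        MvPolynomial.C (((b : ℕ).choose k : ℂ) * ((n - b).choose (k + n - (a + b)) : ℂ)) *
          (x 0 0 ^ k * x 0 1 ^ (a - k) * x 1 0 ^ (b - k) * x 1 1 ^ (k + n - (a + b))))), ?_, ?_⟩
  · have hdet : (x 0 0 * x 1 1 - x 0 1 * x 1 0).IsHomogeneous 2 :=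
      ((hx 0 0).mul (hx 1 1)).sub ((hx 0 1).mul (hx 1 0))
    have hsum : (∑ k ∈ Finset.Icc ((a : ℕ) + b - n) (min a b),
        MvPolynomial.C (((b : ℕ).choose k : ℂ) * ((n - b).choose (k + n - (a + b)) : ℂ)) *
          (x 0 0 ^ k * x 0 1 ^ (a - k) * x 1 0 ^ (b - k) *
            x 1 1 ^ (k + n - (a + b)))).IsHomogeneous n := by
      refine MvPolynomial.IsHomogeneous.sum _ _ _ fun k hk => ?_
      simp only [Finset.mem_Icc, le_min_iff] at hk
      have := (MvPolynomial.isHomogeneous_C (Fin 2 × Fin 2)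
        (((b : ℕ).choose k : ℂ) * ((n - b).choose (k + n - (a + b)) : ℂ))).mul
        (((((hx 0 0).pow k).mul ((hx 0 1).pow (a - k))).mul ((hx 1 0).pow (b - k))).mul
          ((hx 1 1).pow (k + n - (a + b))))
      convert! this using 1
      omega
    have := (MvPolynomial.isHomogeneous_C (Fin 2 × Fin 2) (√(radialConst lam n m) : ℂ)).mul
      ((hdet.pow m).mul ((MvPolynomial.isHomogeneous_C (Fin 2 × Fin 2)
        (√((((a : ℕ).factorial * (n - a).factorial : ℕ) : ℝ) /
        (((b : ℕ).factorial * (n - b).factorial : ℕ) : ℝ)) : ℂ)).mul hsum))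
    convert! this using 1
    simp only
    ring
  · intro Z
    rw [basisFun_eq]
    simp only [detWigner, wignerD, Matrix.det_fin_two, Matrix.of_apply, map_mul, map_sum, map_pow,
      map_sub, MvPolynomial.eval_C, MvPolynomial.eval_X, x]
    congr 3
    refine Finset.sum_congr rfl fun k _ => ?_
    ring

/-! ### Completeness of the system -/

lemma differentiable_basisFun (lam : ℕ) (i : BasisIndex) : Differentiable ℂ (basisFun lam i) := by
  unfold basisFun wignerD
  simp only [Matrix.det_fin_two, Matrix.of_apply]
  fun_prop

/-- A square integrable function orthogonal to the basis functions is orthogonal to their span, that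
is, to all homogeneous polynomials. -/
lemma integral_conj_mul_eq_zero_of_mem_wignerSpan {lam : ℕ} (h : 4 ≤ lam) {g : MatSpace → ℂ}
    (hg : MemLp g 2 (nuMeasure lam))
    (horth : ∀ i, ∫ Z, conj (basisFun lam i Z) * g Z ∂(nuMeasure lam) = 0)
    {k : ℕ} {P : MatSpace → ℂ} (hP : P ∈ wignerSpan k) :
    Integrable (fun Z => conj (P Z) * g Z) (nuMeasure lam) ∧
      ∫ Z, conj (P Z) * g Z ∂(nuMeasure lam) = 0 := by
  induction hP using Submodule.span_induction with
  | mem f hf =>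
    obtain ⟨n, m, a, b, -, ha, hb, rfl⟩ := hf
    refine ⟨MemLp.integrable_mul (p := 2) (q := 2) (Continuous.memLp_nuMeasure h
      (Complex.continuous_conj.comp (continuous_detWigner n m a b)) 2) hg, ?_⟩
    have h1 := horth ⟨(n, m), ⟨a, by omega⟩, ⟨b, by omega⟩⟩
    have hr : (√(radialConst lam n m) : ℂ) ≠ 0 := by
      exact_mod_cast (Real.sqrt_pos.2 (radialConst_pos h n m)).ne'
    simp only [basisFun_eq, map_mul, Complex.conj_ofReal, mul_assoc] at h1
    rw [integral_const_mul] at h1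
    exact (mul_eq_zero.1 h1).resolve_left hr
  | zero => simp
  | add f f' _ _ hf hf' =>
    simp only [Pi.add_apply, map_add, add_mul]
    exact ⟨hf.1.add hf'.1, by rw [integral_add hf.1 hf'.1, hf.2, hf'.2, add_zero]⟩
  | smul c f _ hf =>
    simp only [Pi.smul_apply, smul_eq_mul, map_mul, mul_assoc]
    exact ⟨hf.1.const_mul _, by rw [integral_const_mul, hf.2, mul_zero]⟩

/-- Orthogonality to a homogeneous polynomial of degree `d` only involves the Taylor polynomial of
degree `d`. -/
lemma integral_conj_mul_eq_integral_taylor {lam : ℕ} (h : 4 ≤ lam) {g : MatSpace → ℂ}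
    (hg : DifferentiableOn ℂ g cartanDomain) {d : ℕ} {P Q : MatSpace → ℂ} (hP : P ∈ homPoly d)
    (hQ : ∀ Z : MatSpace, iteratedDeriv d (fun ζ : ℂ => g (ζ • Z)) 0 = Q Z)
    (hint : Integrable (fun Z => conj (P Z) * g Z) (nuMeasure lam)) :
    ∫ Z, conj (P Z) * g Z ∂(nuMeasure lam) =
      (d.factorial : ℂ)⁻¹ * ∫ Z, conj (P Z) * Q Z ∂(nuMeasure lam) := by
  have := isFiniteMeasure_nuMeasure h
  set F : MatSpace → ℂ := fun Z => conj (P Z) * cartanDomain.indicator g Z with hF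
  have hFm : Measurable F :=
    (Complex.continuous_conj.comp (continuous_of_mem_homPoly hP)).measurable.mul
      (measurable_indicator_of_differentiableOn isOpen_cartanDomain hg)
  have hae : (fun Z => conj (P Z) * g Z) =ᵐ[nuMeasure lam] F := by
    filter_upwards [ae_mem_cartanDomain lam] with Z hZ
    simp only [hF, Set.indicator_of_mem hZ]
  rw [integral_congr_ae hae, integral_eq_integral_circleAverage
    (fun c hc => measurePreserving_smul_nuMeasure h hc) hFm (hint.congr hae),
    ← integral_const_mul]
  apply integral_congr_ae
  filter_upwards [ae_mem_cartanDomain lam] with Z hZ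
  obtain ⟨R, hR, hball⟩ := exists_one_lt_smul_mem_cartanDomain hZ
  have hgd : DifferentiableOn ℂ (fun ζ : ℂ => g (ζ • Z)) (Metric.ball 0 R) :=
    hg.comp (by fun_prop) hball
  have h1 : Real.circleAverage (fun ζ => F (ζ • Z)) 0 1 =
      Real.circleAverage (fun ζ => conj (P Z) • (conj ζ ^ d * g (ζ • Z))) 0 1 := by
    apply Real.circleAverage_congr_sphere
    intro ζ hζ
    have hζ1 : ‖ζ‖ = 1 := by simpa using hζ
    simp only [hF, Set.indicator_of_mem (smul_mem_cartanDomain hZ hζ1.le), smul_of_mem_homPoly hP,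
      map_mul, map_pow, smul_eq_mul]
    ring
  have h2 : Real.circleAverage (fun ζ => conj (P Z) • (conj ζ ^ d * g (ζ • Z))) 0 1 =
      conj (P Z) • Real.circleAverage (fun ζ => conj ζ ^ d * g (ζ • Z)) 0 1 :=
    Real.circleAverage_fun_smul
  rw [h1, h2, circleAverage_conj_pow_mul hR hgd, hQ, smul_eq_mul]
  ring

/-- A square integrable holomorphic function orthogonal to the basis functions vanishes: all its
homogeneous Taylor polynomials vanish. -/
lemma ae_eq_zero_of_orthogonal {lam : ℕ} (h : 4 ≤ lam) {g : MatSpace → ℂ}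
    (hgd : DifferentiableOn ℂ g cartanDomain) (hg : MemLp g 2 (nuMeasure lam))
    (horth : ∀ i, ∫ Z, conj (basisFun lam i Z) * g Z ∂(nuMeasure lam) = 0) :
    g =ᵐ[nuMeasure lam] 0 := by
  choose P hP hPe using fun d => exists_homPoly_iteratedDeriv d isOpen_cartanDomain
    zero_mem_cartanDomain hgd
  have hzero : ∀ d, ∀ᵐ Z ∂(nuMeasure lam), P d Z = 0 := by
    intro d
    obtain ⟨hi, h0⟩ := integral_conj_mul_eq_zero_of_mem_wignerSpan h hg horth
      (homPoly_le_wignerSpan d (hP d))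
    rw [integral_conj_mul_eq_integral_taylor h hgd (hP d) (hPe d) hi] at h0
    have hf : (d.factorial : ℂ)⁻¹ ≠ 0 := by
      simp [d.factorial_ne_zero]
    have h1 := (mul_eq_zero.1 h0).resolve_left hf
    have hc := continuous_of_mem_homPoly (hP d)
    simp only [← sq_norm_eq_conj_mul] at h1
    rw [integral_complex_ofReal, Complex.ofReal_eq_zero, integral_eq_zero_iff_of_nonneg
      (fun Z => by positivity)] at h1
    · filter_upwards [h1] with Z hZ
      simpa using hZ
    · have := Continuous.integrable_nuMeasure h (continuous_conj_mul hc hc)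
      simp only [← sq_norm_eq_conj_mul] at this
      exact this.re
  filter_upwards [ae_all_iff.2 hzero, ae_mem_cartanDomain lam] with Z hZ hZD
  obtain ⟨R, hR, hball⟩ := exists_one_lt_smul_mem_cartanDomain hZD
  have hd : DifferentiableOn ℂ (fun ζ : ℂ => g (ζ • Z)) (Metric.ball 0 R) :=
    hgd.comp (by fun_prop) hball
  have h1 := Complex.taylorSeries_eq_on_ball hd (z := 1) (by simpa using hR)
  simp only [hPe, hZ, smul_zero, tsum_zero, one_smul] at h1
  exact h1.symm

/-- The class in `L²_h(D₄, ν_λ)` of a basis function. -/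
noncomputable def basisVec {lam : ℕ} (h : 4 ≤ lam) (i : BasisIndex) : holoL2 lam :=
  ⟨(Continuous.memLp_nuMeasure h (continuous_basisFun lam i) 2).toLp (basisFun lam i),
    basisFun lam i, (differentiable_basisFun lam i).differentiableOn, MemLp.coeFn_toLp _⟩

lemma coeFn_basisVec {lam : ℕ} (h : 4 ≤ lam) (i : BasisIndex) :
    ((basisVec h i : Lp ℂ 2 (nuMeasure lam)) : MatSpace → ℂ) =ᵐ[nuMeasure lam] basisFun lam i :=
  MemLp.coeFn_toLp (Continuous.memLp_nuMeasure h (continuous_basisFun lam i) 2)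

lemma inner_basisVec {lam : ℕ} (h : 4 ≤ lam) (i : BasisIndex) (f : holoL2 lam) :
    inner ℂ (basisVec h i) f =
      ∫ Z, conj (basisFun lam i Z) * (f : Lp ℂ 2 (nuMeasure lam)) Z ∂(nuMeasure lam) := by
  rw [Submodule.coe_inner, L2.inner_def]
  apply integral_congr_ae
  filter_upwards [coeFn_basisVec h i] with Z hZ
  rw [hZ, RCLike.inner_apply']

/-- For every integer `λ ≥ 4`, the functions `φ^{j,m}_{q₁,q₂}` are homogeneous polynomials of degree
`2j + 2m`, they are square integrable and orthonormal with respect to `dν_λ`, and they form an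
orthonormal (Hilbert) basis of `L²_h(D₄, dν_λ)`. -/
theorem mainTheorem4 (lam : ℕ) (hlam : 4 ≤ lam) :
    (∀ i : BasisIndex, ∃ p : MvPolynomial (Fin 2 × Fin 2) ℂ,
      p.IsHomogeneous (i.1.1 + 2 * i.1.2) ∧
        ∀ Z : MatSpace, basisFun lam i Z = MvPolynomial.eval (fun ij => Z ij.1 ij.2) p) ∧
    (∀ i : BasisIndex, MemLp (basisFun lam i) 2 (nuMeasure lam)) ∧
    (∀ i i' : BasisIndex,
      ∫ Z, conj (basisFun lam i Z) * basisFun lam i' Z ∂(nuMeasure lam) =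
        if i = i' then 1 else 0) ∧
    (∃ e : HilbertBasis BasisIndex ℂ (holoL2 lam),
      ∀ i : BasisIndex, ((e i : Lp ℂ 2 (nuMeasure lam)) : MatSpace → ℂ)
        =ᵐ[nuMeasure lam] basisFun lam i) := by
  refine ⟨exists_mvPolynomial_basisFun lam,
    fun i => Continuous.memLp_nuMeasure hlam (continuous_basisFun lam i) 2,
    integral_conj_basisFun hlam, ?_⟩
  have hcomplete : CompleteSpace (holoL2 lam) := (isClosed_holoL2 hlam).completeSpace_coe
  have hon : Orthonormal ℂ (basisVec hlam) := by
    rw [orthonormal_iff_ite]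
    intro i i'
    rw [inner_basisVec, ← integral_conj_basisFun hlam i i']
    apply integral_congr_ae
    filter_upwards [coeFn_basisVec hlam i'] with Z hZ
    rw [hZ]
  have hspan : (Submodule.span ℂ (Set.range (basisVec hlam)))ᗮ = ⊥ := by
    rw [Submodule.eq_bot_iff]
    intro f hf
    obtain ⟨g, hgd, hfg⟩ := f.2
    have hg : MemLp g 2 (nuMeasure lam) := (memLp_congr_ae hfg).1 (Lp.memLp _)
    have h0 := ae_eq_zero_of_orthogonal hlam hgd hg fun i => by
      have h1 : inner ℂ (basisVec hlam i) f = 0 :=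
        hf _ (Submodule.subset_span ⟨i, rfl⟩)
      rw [inner_basisVec] at h1
      rw [← h1]
      apply integral_congr_ae
      filter_upwards [hfg] with Z hZ
      rw [hZ]
    apply Subtype.ext
    exact (Lp.eq_zero_iff_ae_eq_zero).2 (hfg.trans h0)
  refine ⟨HilbertBasis.mkOfOrthogonalEqBot hon hspan, fun i => ?_⟩
  rw [HilbertBasis.coe_mkOfOrthogonalEqBot]
  exact coeFn_basisVec hlam i
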